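/- Let $N\ge 0$, let $q\ge 0$ be even, let $J\ge 0$ and $t\ge 0$. Let $\psi_1,\dots,\psi_N$ be Majorana fermions: Hermitian operators with $\{\psi_i,\psi_j\}=2\delta_{ij}$ on $\mathbb C^d$, in the irreducible dimension $d=2^{\lfloor N/2\rfloor}$. For $\alpha=\{i_1<\dots<i_s\}\subseteq\{1,\dots,N\}$ let $\psi_\alpha=\psi_{i_1}\cdots\psi_{i_s}$, $|\alpha|=s$. The Choi state of an operator $A$ is $|A\rangle=d^{-1/2}\sum_{i,j}A_{ij}|i\rangle|j^*\rangle$, and $\mathbf 1$ is the identity operator. *Brownian SYK.* The Hamiltonian is $H(t)=(-\mathrm i)^{q/2}\sum_{|\alpha|=q}g_\alpha(t)\psi_\alpha$, with independent centred Gaussian white-noise couplings, $\overline{g_\alpha(t)g_{\alpha'}(t')}=J\delta_{\alpha\alpha'}\delta(t-t')$. Let $U(t)$ be its time-ordered evolution; averages are taken as the limit $M\to\infty$ of the circuit of $M$ gates $\exp\bigl(-\mathrm i(-\mathrm i)^{q/2}\sum_{|\alpha|=q} x_{m,\alpha}\psi_\alpha\bigr)$ with independent $x_{m,\alpha}\sim\mathcal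 N(0,Jt/M)$. For $n\ge1$ independent draws $U_1,\dots,U_n$ the overlap moment is $$Z_n(t)=\overline{\langle U_1(t)|U_2(t)\rangle\langle U_2(t)|U_3(t)\rangle\cdots\langle U_n(t)|U_1(t)\rangle}.$$ *Energies and the operator $\rho_t$.* Let $$E(s)=J\binom Nq\bigl[1-{}_2F_1(-q,-s;-N;2)\bigr],\qquad \lambda_t(s)=\frac1{2^N}\sum_{l=0}^N e^{-tE(l)}\sum_{j=0}^s(-1)^j\binom sj\binom{N-s}{l-j},$$ where binomial coefficients with a negative lower entry vanish, and let $$\rho_t=\sum_{|\alpha|\ \mathrm{even}}\lambda_t(|\alpha|)\,|\psi_\alpha\rangle\langle\psi_\alpha| .$$ Then, for all $N$ (even or odd, including $N\equiv4\pmod 8$): 1. The states $|\psi_\alpha\rangle$ with $|\alpha|$ even are orthonormal, and $\rho_t|\psi_\alpha\rangle=\lambda_t(|\alpha|)\,|\psi_\alpha\rangle$. 2. For every $n\ge1$ the limit defining $Z_n(t)$ exists and $$Z_n(t)=\mathrm{Tr}(\rho_t^n)=\sum_{\substack{0\le s\le N\\ s\text{ even}}}\binom Ns\lambda_t(s)^n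 .$$ 3. For every $n\ge1$ the same value is taken by $\langle\eta|\,e^{-tH_{\mathrm{eff}}^{1\bar1}}\otimes\cdots\otimes e^{-tH_{\mathrm{eff}}^{n\bar n}}\,|\eta\rangle$, where $$H_{\mathrm{eff}}^{a\bar b}=\frac J2\,\mathrm i^q\sum_{|\alpha|=q}\bigl(\psi_\alpha^a-(-1)^{q/2}\psi_\alpha^{\bar b}\bigr)^2$$ (an operator on a replica $\bar b$ acts by its complex conjugate), $\eta=(1\,2\cdots n)$ and $|\eta\rangle=\bigotimes_a|\mathbf 1\rangle_{a\,\overline{\eta(a)}}$. 4. Let $\mathcal A$ be any set of subsets $\alpha\subseteq\{1,\dots,N\}$ with $|\alpha|\le N/2$ that contains exactly one of $\alpha,\alpha^c$ for each $\alpha$ (for $N$ odd: all $\alpha$ with $|\alpha|<N/2$). For every $n\ge1$ the same value is taken, for even $N\ge 2$, by $$\frac1{2^{n(N-1)}}\sum_{\alpha_1,\dots,\alpha_n\in\mathcal A}e^{-t(E(|\alpha_1|)+\dots+E(|\alpha_n|))}\sum_{f_1,\dots,f_n=\pm1}\bigl|\mathrm{Tr}(\Pi_{f_1}\psi_{\alpha_1}\Pi_{f_2}\psi_{\alpha_2}\cdots\Pi_{f_n}\psi_{\alpha_n})\bigr|^2,$$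 with the fermion parity projectors $\Pi_f=\tfrac12(1+f(-1)^F)$, $(-1)^F=(-\mathrm i)^{N/2}\psi_1\cdots\psi_N$; and for odd $N$ by $$\frac1{2^{n(N-1)}}\sum_{\alpha_1,\dots,\alpha_n\in\mathcal A}e^{-t(E(|\alpha_1|)+\dots+E(|\alpha_n|))}\bigl|\mathrm{Tr}(\psi_{\alpha_1}\cdots\psi_{\alpha_n})\bigr|^2 .$$ -/

import Mathlib

open scoped Kronecker

noncomputable section

namespace BrownianSYK

open Matrix

variable {ι : Type*} [Fintype ι] [DecidableEq ι]

/-- `N` Majorana fermions, irreducibly represented on the Hilbert space `ℂ^ι`: Hermitian matrices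
with `{ψᵢ, ψⱼ} = 2 δᵢⱼ`, on a space of dimension `2 ^ ⌊N / 2⌋`. -/
structure IsMajorana {N : ℕ} (ψ : Fin N → Matrix ι ι ℂ) : Prop where
  isHermitian : ∀ i, (ψ i).IsHermitian
  anticomm : ∀ i j, ψ i * ψ j + ψ j * ψ i = if i = j then 2 else 0
  card_eq : Fintype.card ι = 2 ^ (N / 2)

/-- The Majorana string `ψ_α = ψ_{i₁} ⋯ ψ_{iₛ}`, where `α = {i₁ < ⋯ < iₛ}`. -/
def majString {N : ℕ} (ψ : Fin N → Matrix ι ι ℂ) (α : Finset (Fin N)) : Matrix ι ι ℂ :=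
  ((α.sort (· ≤ ·)).map ψ).prod

/-- The index set of the `q`-body strings. -/
abbrev Strings (N q : ℕ) : Type := {α : Finset (Fin N) // α.card = q}

/-! ### The Brownian ensemble and its overlap moments -/

/-- The Hermitian drive operators `(-i)^{q/2} ψ_α`. -/
def driveOp {N : ℕ} (ψ : Fin N → Matrix ι ι ℂ) (q : ℕ) (α : Strings N q) : Matrix ι ι ℂ :=
  (-Complex.I) ^ (q / 2) • majString ψ α.1

/-- The gate `exp (-i ∑_α x_α 𝒪_α)`; here `x_α = g_α δt` is the integrated coupling of the step. -/
def gate {N : ℕ} (ψ : Fin N → Matrix ι ι ℂ) (q : ℕ) (x : Strings N q → ℝ) : Matrix ι ι ℂ :=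
  NormedSpace.exp (-Complex.I • ∑ α, (x α : ℂ) • driveOp ψ q α)

/-- The time-ordered product of `M` gates, with later times to the left. -/
def evolution {N : ℕ} (ψ : Fin N → Matrix ι ι ℂ) (q M : ℕ) (x : Fin M → Strings N q → ℝ) :
    Matrix ι ι ℂ :=
  (List.ofFn fun m : Fin M => gate ψ q (x m.rev)).prod

/-- The law of white-noise couplings of variance `J`, integrated over `M` steps of length `t / M`:
all `x_{m, α}` are independent, centred Gaussians of variance `J t / M`. -/
def couplingLaw (N q M : ℕ) (J t : ℝ) : MeasureTheory.Measure (Fin M → Strings N q → ℝ) :=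
  MeasureTheory.Measure.pi fun _ => MeasureTheory.Measure.pi fun _ =>
    ProbabilityTheory.gaussianReal 0 (Real.toNNReal (J * t / M))

/-- The Choi state `d^{-1/2} ∑ A_{ij} |i⟩|j*⟩` of an operator `A`, where `d = |ι|`. -/
def choi (A : Matrix ι ι ℂ) : ι × ι → ℂ :=
  fun p => ((Real.sqrt (Fintype.card ι))⁻¹ : ℝ) * A p.1 p.2

/-- The average of `⟨U₁|U₂⟩⟨U₂|U₃⟩ ⋯ ⟨Uₙ|U₁⟩` over `n` independent draws from the Brownian
circuit of total time `t` with `M` time steps. -/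
def discreteMoment {N : ℕ} (ψ : Fin N → Matrix ι ι ℂ) (q n M : ℕ) (J t : ℝ) : ℂ :=
  ∫ x : Fin n → Fin M → Strings N q → ℝ,
    ∏ a, star (choi (evolution ψ q M (x a))) ⬝ᵥ choi (evolution ψ q M (x (finRotate n a)))
    ∂(MeasureTheory.Measure.pi fun _ => couplingLaw N q M J t)

/-! ### The effective Hamiltonian -/

/-- The two-replica effective Hamiltonian
`(J / 2) i^q ∑_{|α| = q} (ψ_α^a - (-1)^{q/2} ψ_α^{b̄})²` on `ℂ^ι ⊗ ℂ^ι`; an operator of the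
replica `b̄` acts by its complex conjugate. -/
def Heff {N : ℕ} (ψ : Fin N → Matrix ι ι ℂ) (q : ℕ) (J : ℝ) : Matrix (ι × ι) (ι × ι) ℂ :=
  (((J / 2 : ℝ) : ℂ) * Complex.I ^ q) • ∑ α : Strings N q,
    (majString ψ α.1 ⊗ₖ (1 : Matrix ι ι ℂ)
      - (-1 : ℂ) ^ (q / 2) • ((1 : Matrix ι ι ℂ) ⊗ₖ (majString ψ α.1).map star)) ^ 2

/-- The state `|σ⟩ = ⨂_a |𝟏⟩_{a, σ(a)‾}` of `2n` replicas, where `|𝟏⟩ = d^{-1/2} ∑ |i⟩|i*⟩`. The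
basis vector `x` has the label `(x a).1` in the replica `a` and `(x a).2` in the replica `a‾`. -/
def permState (n : ℕ) (σ : Equiv.Perm (Fin n)) : (Fin n → ι × ι) → ℂ :=
  fun x => ∏ a, choi (1 : Matrix ι ι ℂ) ((x a).1, (x (σ a)).2)

/-- `⟨η| e^{-t H_eff} ⊗ ⋯ ⊗ e^{-t H_eff} |η⟩` with `n` tensor factors, the `a`-th one on the
replicas `a` and `a‾`, and with `η = (1 2 ⋯ n)`. -/
def replicaMoment {N : ℕ} (ψ : Fin N → Matrix ι ι ℂ) (q n : ℕ) (J t : ℝ) : ℂ :=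
  ∑ x : Fin n → ι × ι, ∑ y : Fin n → ι × ι,
    star (permState n (finRotate n) x)
      * (∏ a, NormedSpace.exp (-(t : ℂ) • Heff ψ q J) (x a) (y a))
      * permState n (finRotate n) y

/-- `E(s) = J K [1 - ₂F₁(-q, -s; -N; 2)]` with `K = N.choose q`. -/
def energy (N q : ℕ) (J : ℝ) (s : ℕ) : ℝ :=
  J * N.choose q * (1 - ordinaryHypergeometric (-(q : ℝ)) (-(s : ℝ)) (-(N : ℝ)) (2 : ℝ))

/-! ### The moments as sums over Majorana strings -/

/-- A choice of labels of the Majorana basis: strings of length at most `N / 2`, exactly one from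
each pair of complementary strings (a genuine choice only for the length `N / 2`). -/
structure IsHalf {N : ℕ} (A : Finset (Finset (Fin N))) : Prop where
  card_le : ∀ α ∈ A, 2 * α.card ≤ N
  xor_compl : ∀ α, Xor (α ∈ A) (αᶜ ∈ A)

/-- The projector `Π_f = (1 + f (-1)^F) / 2`, for `N` even, where
`(-1)^F = (-i)^{N/2} ψ_1 ⋯ ψ_N`. -/
def parityProj {N : ℕ} (ψ : Fin N → Matrix ι ι ℂ) (f : ℤˣ) : Matrix ι ι ℂ :=
  (1 / 2 : ℂ) • (1 + (((f : ℤ) : ℂ) * (-Complex.I) ^ (N / 2)) • majString ψ Finset.univ)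

/-- The sum over Majorana strings and fermion parities, for `N` even. -/
def stringMomentEven {N : ℕ} (ψ : Fin N → Matrix ι ι ℂ) (A : Finset (Finset (Fin N)))
    (q n : ℕ) (J t : ℝ) : ℝ :=
  1 / 2 ^ (n * (N - 1)) * ∑ α ∈ Fintype.piFinset fun _ : Fin n => A,
    Real.exp (-t * ∑ a, energy N q J (α a).card) * ∑ f : Fin n → ℤˣ,
      ‖(List.ofFn fun a => parityProj ψ (f a) * majString ψ (α a)).prod.trace‖ ^ 2

/-- The sum over Majorana strings, for `N` odd. -/
def stringMomentOdd {N : ℕ} (ψ : Fin N → Matrix ι ι ℂ) (A : Finset (Finset (Fin N)))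
    (q n : ℕ) (J t : ℝ) : ℝ :=
  1 / 2 ^ (n * (N - 1)) * ∑ α ∈ Fintype.piFinset fun _ : Fin n => A,
    Real.exp (-t * ∑ a, energy N q J (α a).card) *
      ‖(List.ofFn fun a => majString ψ (α a)).prod.trace‖ ^ 2

/-! ### The operator `ρ_t` -/

/-- `λ_t(s) = 2^{-N} ∑_{l=0}^N e^{-t E(l)} ∑_{j=0}^s (-1)^j (s choose j) (N-s choose l-j)`, where a
binomial coefficient with a negative lower entry is zero. -/
def eigval (N q : ℕ) (J t : ℝ) (s : ℕ) : ℝ :=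
  1 / 2 ^ N * ∑ l ∈ Finset.range (N + 1), Real.exp (-t * energy N q J l) *
    ∑ j ∈ Finset.range (s + 1),
      if j ≤ l then (-1) ^ j * (s.choose j : ℝ) * ((N - s).choose (l - j) : ℝ) else 0

/-- `ρ_t = ∑_α λ_t(|α|) |ψ_α⟩⟨ψ_α|`, summed over the strings of even length, where `|ψ_α⟩` is the
Choi state of `ψ_α`. -/
def rho {N : ℕ} (ψ : Fin N → Matrix ι ι ℂ) (q : ℕ) (J t : ℝ) : Matrix (ι × ι) (ι × ι) ℂ :=
  ∑ α : Finset (Fin N) with Even α.card,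
    (eigval N q J t α.card : ℂ) •
      Matrix.vecMulVec (choi (majString ψ α)) (star (choi (majString ψ α)))

end BrownianSYK

end

/-!
The doubled strings `W_α = ψ_α ⊗ ψ_α*` are insensitive to the phase of `ψ_α`, so they represent
the group of subsets of `Fin N` under symmetric difference, whose characters are `α ↦ (-1)^{|α ∩
β|}` (`sgn`). The effective Hamiltonian is `J ∑_{|α| = q} (1 - W_α)`; by a Krawtchouk sum it takes
the value `E(|β|)` on the character of `β` (`energy_card`). Fourier inversion on this finite group
(`IsMajorana.calculus`) therefore gives `e^{-t H_eff} = ∑_α λ_t(|α|) W_α` (`IsMajorana.exp_Heff`),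
where `λ_t(|α|)` vanishes for `|α|` odd because `E(N - s) = E(s)`. The realignment sending `U ⊗
U*` to `|U⟩⟨U|` sends `W_α` to `|ψ_α⟩⟨ψ_α|`, and so `e^{-t H_eff}` to `ρ_t`
(`IsMajorana.realign_exp_Heff`).

The trace of the `n`-th power of a realigned operator is a cyclic contraction (`sum_cycle_prod`).
This identifies the replica moment with `Tr ρ_tⁿ` (`replicaMoment_eq`). Since each draw occurs
once as a bra and once as a ket, the averaged overlaps of the circuit of `M` gates form the same
contraction of the average of `U ⊗ U*` (`discreteMoment_eq`). That average is the `M`-th power of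
the average of the doubled gate, which by a second-order Gaussian expansion is `1 - (t / M) H_eff
+ O(M^{-3/2})`; hence it tends to `e^{-t H_eff}` (`tendsto_integral_exp_pow`).

Even strings are orthonormal because nontrivial even strings are traceless, which gives `Tr ρ_tⁿ =
∑_{|γ| even} λ_t(|γ|)ⁿ`. Expanding `λ_t(|γ|)ⁿ` as a sum over characters, one representative of
each complementary pair, leaves the weights `∑_{|γ| even} ∏_a (-1)^{|γ ∩ α_a|}`. These are squared
traces of products of strings. For `N` odd this uses that `ψ_1 ⋯ ψ_N` is a scalar, which is read
off from Parseval's identity in the basis of even strings (`IsMajorana.sq_norm_trace_univ`); for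
`N` even the sum over parities supplies the restriction to even `γ` (`IsMajorana.paritySum_one`).
-/

noncomputable section

namespace BrownianSYK

open Matrix

section
/-! ### Characters of the group of subsets, and the energies -/

variable {N : ℕ}

/-- The character `(-1)^{|α ∩ β|}` of the group of subsets under symmetric difference. -/
def sgn (α β : Finset (Fin N)) : ℤ := (-1) ^ (α ∩ β).card

lemma sgn_comm (α β : Finset (Fin N)) : sgn α β = sgn β α := by
  rw [sgn, sgn, Finset.inter_comm]

lemma sgn_eq_prod (α β : Finset (Fin N)) :
    sgn α β = ∏ i ∈ β, if i ∈ α then (-1 : ℤ) else 1 := by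
  rw [sgn, Finset.prod_ite, Finset.prod_const, Finset.prod_const_one, mul_one,
    Finset.filter_mem_eq_inter, Finset.inter_comm]

lemma sgn_symmDiff (α β γ : Finset (Fin N)) : sgn (symmDiff α β) γ = sgn α γ * sgn β γ := by
  simp only [sgn_eq_prod, ← Finset.prod_mul_distrib]
  refine Finset.prod_congr rfl fun i _ => ?_
  by_cases h1 : i ∈ α <;> by_cases h2 : i ∈ β <;> simp [Finset.mem_symmDiff, h1, h2]

lemma sgn_univ_left (α : Finset (Fin N)) : sgn Finset.univ α = (-1) ^ α.card := by
  simp [sgn]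

@[simp] lemma sgn_empty_left (α : Finset (Fin N)) : sgn ∅ α = 1 := by simp [sgn]

@[simp] lemma sgn_empty_right (α : Finset (Fin N)) : sgn α ∅ = 1 := by simp [sgn]

lemma sgn_compl_right (α β : Finset (Fin N)) : sgn α βᶜ = (-1) ^ α.card * sgn α β := by
  have h : βᶜ = symmDiff Finset.univ β := by ext i; simp [Finset.mem_symmDiff]
  rw [sgn_comm, h, sgn_symmDiff, sgn_univ_left, sgn_comm β]

lemma sum_sgn (α : Finset (Fin N)) : ∑ β, sgn α β = if α = ∅ then 2 ^ N else 0 := by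
  have h := Finset.prod_one_add (f := fun i => if i ∈ α then (-1 : ℤ) else 1) Finset.univ
  rw [Finset.powerset_univ] at h
  simp only [sgn_eq_prod, ← h]
  split_ifs with hα
  · subst hα; simp
  · obtain ⟨i, hi⟩ := Finset.nonempty_iff_ne_empty.mpr hα
    exact Finset.prod_eq_zero (Finset.mem_univ i) (by simp [hi])

lemma symmDiff_eq_empty {α β : Finset (Fin N)} : symmDiff α β = ∅ ↔ α = β := by
  rw [← Finset.bot_eq_empty, symmDiff_eq_bot]

lemma sum_sgn_mul_sgn (α β : Finset (Fin N)) :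
    ∑ γ, sgn α γ * sgn β γ = if α = β then 2 ^ N else 0 := by
  simp only [← sgn_symmDiff, sum_sgn, symmDiff_eq_empty]

/-- The sums of `sgn` over the sets of given size are the coefficients of
`(1 - X)^{|α|} (1 + X)^{N - |α|}`, i.e. the values of a Krawtchouk polynomial. -/
lemma sum_sgn_card_eq_coeff (α : Finset (Fin N)) (l : ℕ) :
    ∑ β : Finset (Fin N) with β.card = l, sgn α β =
      ((1 - Polynomial.X) ^ α.card * (1 + Polynomial.X) ^ (N - α.card) :
        Polynomial ℤ).coeff l := by
  have h := Finset.prod_one_add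
    (f := fun i => if i ∈ α then -(Polynomial.X : Polynomial ℤ) else Polynomial.X) Finset.univ
  have h1 : (∏ i, (1 + if i ∈ α then -(Polynomial.X : Polynomial ℤ) else Polynomial.X)) =
      (1 - Polynomial.X) ^ α.card * (1 + Polynomial.X) ^ (N - α.card) := by
    rw [← Finset.prod_mul_prod_compl α, Finset.prod_congr rfl
      (g := fun _ => 1 - (Polynomial.X : Polynomial ℤ)) (fun i hi => by simp [hi, sub_eq_add_neg]),
      Finset.prod_congr (s₁ := αᶜ) rfl (g := fun _ => 1 + (Polynomial.X : Polynomial ℤ))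
        (fun i hi => by simp [Finset.mem_compl.mp hi])]
    simp [Finset.card_compl]
  have h2 : ∀ β : Finset (Fin N),
      (∏ i ∈ β, if i ∈ α then -(Polynomial.X : Polynomial ℤ) else Polynomial.X) =
        Polynomial.C (sgn α β) * Polynomial.X ^ β.card := by
    intro β
    rw [sgn_eq_prod, map_prod, ← Finset.prod_const, ← Finset.prod_mul_distrib]
    exact Finset.prod_congr rfl fun i _ => by split_ifs <;> simp
  rw [← h1, h, Finset.powerset_univ]
  simp only [h2, Polynomial.finsetSum_coeff, Polynomial.coeff_C_mul, Polynomial.coeff_X_pow,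
    Finset.sum_filter, mul_ite, mul_one, mul_zero, eq_comm]

/-- Expanding `(1 - X)^{|α|}` gives the double binomial sum in the definition of `λ_t`. -/
lemma sum_sgn_card (α : Finset (Fin N)) (l : ℕ) :
    ∑ β : Finset (Fin N) with β.card = l, sgn α β =
      ∑ j ∈ Finset.range (α.card + 1),
        if j ≤ l then (-1) ^ j * (α.card.choose j : ℤ) * ((N - α.card).choose (l - j) : ℤ)
          else 0 := by
  rw [sum_sgn_card_eq_coeff]
  have h : (1 - Polynomial.X : Polynomial ℤ) ^ α.card =
      ∑ j ∈ Finset.range (α.card + 1),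
        Polynomial.C ((-1) ^ j * (α.card.choose j : ℤ)) * Polynomial.X ^ j := by
    rw [sub_eq_neg_add, add_pow]
    refine Finset.sum_congr rfl fun j _ => ?_
    rw [neg_pow]; simp; ring
  rw [h, Finset.sum_mul, Polynomial.finsetSum_coeff]
  refine Finset.sum_congr rfl fun j _ => ?_
  rw [mul_assoc, Polynomial.coeff_C_mul, Polynomial.coeff_X_pow_mul']
  split_ifs
  · rw [Polynomial.coeff_one_add_X_pow]
  · simp

/-- Expanding `(1 - X)^{|α|} = ((1 + X) - 2 X)^{|α|}` gives the terminating series of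
`₂F₁` at `2`. -/
lemma sum_sgn_card' (α : Finset (Fin N)) (l : ℕ) :
    ∑ β : Finset (Fin N) with β.card = l, sgn α β =
      ∑ k ∈ Finset.range (α.card + 1),
        if k ≤ l then (-2) ^ k * (α.card.choose k : ℤ) * ((N - k).choose (l - k) : ℤ)
          else 0 := by
  have hα : α.card ≤ N := by simpa using Finset.card_le_univ α
  have h : (1 - Polynomial.X : Polynomial ℤ) ^ α.card * (1 + Polynomial.X) ^ (N - α.card) =
      ∑ k ∈ Finset.range (α.card + 1), Polynomial.C ((-2) ^ k * (α.card.choose k : ℤ)) *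
        (Polynomial.X ^ k * (1 + Polynomial.X) ^ (N - k)) := by
    have h1 : (1 - Polynomial.X : Polynomial ℤ) =
        Polynomial.C (-2) * Polynomial.X + (1 + Polynomial.X) := by
      rw [show (-2 : ℤ) = -(1 + 1) by norm_num, map_neg, map_add, map_one]; ring
    rw [h1, add_pow, Finset.sum_mul]
    refine Finset.sum_congr rfl fun k hk => ?_
    have hk' : k ≤ α.card := Nat.lt_succ_iff.mp (Finset.mem_range.mp hk)
    rw [show N - k = (α.card - k) + (N - α.card) by omega, pow_add, mul_pow, map_mul, map_pow]
    simp only [map_natCast]; ring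
  rw [sum_sgn_card_eq_coeff, h, Polynomial.finsetSum_coeff]
  refine Finset.sum_congr rfl fun j _ => ?_
  rw [mul_assoc, Polynomial.coeff_C_mul, Polynomial.coeff_X_pow_mul']
  split_ifs
  · rw [Polynomial.coeff_one_add_X_pow]; ring
  · simp

lemma eval_ascPochhammer_neg_natCast (n k : ℕ) :
    (ascPochhammer ℝ k).eval (-(n : ℝ)) = (-1) ^ k * (n.descFactorial k : ℝ) := by
  rw [ascPochhammer_eval_neg_eq_descPochhammer, descPochhammer_eval_eq_descFactorial]

lemma choose_mul_descFactorial_div {N q k : ℕ} (hk : k ≤ N) :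
    (N.choose q : ℝ) * q.descFactorial k / N.descFactorial k =
      if k ≤ q then ((N - k).choose (q - k) : ℝ) else 0 := by
  have h0 : (N.descFactorial k : ℝ) ≠ 0 := by
    exact_mod_cast (Nat.descFactorial_pos.mpr hk).ne'
  rw [div_eq_iff h0]
  split_ifs with h
  · rw [Nat.descFactorial_eq_factorial_mul_choose, Nat.descFactorial_eq_factorial_mul_choose]
    have := congrArg (Nat.cast (R := ℝ)) (Nat.choose_mul (n := N) h)
    push_cast at this ⊢
    linear_combination (k.factorial : ℝ) * this
  · simp [Nat.descFactorial_eq_zero_iff_lt.mpr (not_le.mp h)]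

/-- For `s ≤ N` the series terminates before the Pochhammer symbols `(-N)_k` in its denominators
vanish. -/
lemma choose_mul_ordinaryHypergeometric {N q s : ℕ} (hs : s ≤ N) :
    (N.choose q : ℝ) *
      ordinaryHypergeometric (-(q : ℝ)) (-(s : ℝ)) (-(N : ℝ)) (2 : ℝ) =
      ∑ k ∈ Finset.range (s + 1),
        if k ≤ q then (-2) ^ k * (s.choose k : ℝ) * ((N - k).choose (q - k) : ℝ) else 0 := by
  rw [ordinaryHypergeometric_eq_tsum]
  simp only [eval_ascPochhammer_neg_natCast]
  rw [tsum_eq_sum (s := Finset.range (s + 1)), Finset.mul_sum]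
  · refine Finset.sum_congr rfl fun k hk => ?_
    have hk' : k ≤ s := Nat.lt_succ_iff.mp (Finset.mem_range.mp hk)
    have h := choose_mul_descFactorial_div (q := q) (hk'.trans hs)
    have h2 : (s.descFactorial k : ℝ) = k.factorial * s.choose k := by
      exact_mod_cast Nat.descFactorial_eq_factorial_mul_choose s k
    have h3 : (k.factorial : ℝ) ≠ 0 := by exact_mod_cast k.factorial_ne_zero
    have h4 : ((-1 : ℝ) ^ k)⁻¹ = (-1) ^ k := by rw [← inv_pow]; norm_num
    have h5 : ((-1 : ℝ) ^ k) * (-1) ^ k = 1 := by rw [← mul_pow]; norm_num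
    have h6 : (-2 : ℝ) ^ k = (-1) ^ k * 2 ^ k := by rw [← mul_pow]; norm_num
    rw [h2, mul_inv, h4, h6, smul_eq_mul]
    calc _ = ((k.factorial : ℝ)⁻¹ * k.factorial) * ((-1 : ℝ) ^ k * (-1) ^ k) *
          ((-1) ^ k * 2 ^ k * s.choose k) *
            ((N.choose q : ℝ) * q.descFactorial k / N.descFactorial k) := by ring
      _ = _ := by rw [h, h5, inv_mul_cancel₀ h3]; split_ifs <;> ring
  · intro k hk
    have : s < k := by simpa using hk
    simp [Nat.descFactorial_eq_zero_iff_lt.mpr this]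

/-- The energy as a sum over `q`-body strings: it counts twice, with weight `J`, those strings that
anticommute with `ψ_α`. -/
lemma energy_card (q : ℕ) (J : ℝ) (α : Finset (Fin N)) :
    energy N q J α.card = J * ∑ β : Strings N q, (1 - (sgn β.1 α : ℝ)) := by
  have hα : α.card ≤ N := by simpa using Finset.card_le_univ α
  have h1 : ∑ β : Strings N q, (sgn β.1 α : ℝ) =
      ((∑ β : Finset (Fin N) with β.card = q, sgn α β : ℤ) : ℝ) := by
    push_cast
    rw [← Finset.sum_subtype_eq_sum_filter]
    simp [sgn_comm]
  have h2 : (Fintype.card (Strings N q) : ℝ) = N.choose q := by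
    simp [Strings]
  rw [Finset.sum_sub_distrib, h1, sum_sgn_card', Finset.sum_const, Finset.card_univ, nsmul_eq_mul,
    h2, energy, mul_assoc, mul_sub, choose_mul_ordinaryHypergeometric hα]
  push_cast
  simp

/-- As `q` is even, a string and its complement have the same energy. -/
lemma energy_card_compl {q : ℕ} (hq : Even q) (J : ℝ) (α : Finset (Fin N)) :
    energy N q J αᶜ.card = energy N q J α.card := by
  simp only [energy_card, sgn_compl_right]
  congr 1
  refine Finset.sum_congr rfl fun β _ => ?_
  rw [β.2, hq.neg_one_pow, one_mul]

/-- `λ_t` is the Fourier transform of `β ↦ e^{-t E(|β|)}`. -/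
lemma eigval_card (q : ℕ) (J t : ℝ) (α : Finset (Fin N)) :
    eigval N q J t α.card =
      1 / 2 ^ N * ∑ β : Finset (Fin N), Real.exp (-t * energy N q J β.card) * sgn α β := by
  rw [eigval]
  congr 1
  rw [← Finset.sum_fiberwise_of_maps_to (s := Finset.univ) (t := Finset.range (N + 1))
    (g := Finset.card) (fun β _ => by simpa [Nat.lt_succ_iff] using Finset.card_le_univ β)]
  refine Finset.sum_congr rfl fun l _ => ?_
  have h := congrArg (Int.cast (R := ℝ)) (sum_sgn_card α l)
  push_cast at h
  rw [← h, Finset.mul_sum]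
  exact Finset.sum_congr rfl fun β hβ => by rw [(Finset.mem_filter.mp hβ).2]

/-- For `|α|` odd, complementary sets contribute with opposite signs. -/
lemma eigval_card_eq_zero_of_odd {q : ℕ} (hq : Even q) (J t : ℝ) {α : Finset (Fin N)}
    (hα : ¬ Even α.card) : eigval N q J t α.card = 0 := by
  rw [eigval_card]
  have h : ∑ β : Finset (Fin N), Real.exp (-t * energy N q J β.card) * sgn α β =
      -∑ β : Finset (Fin N), Real.exp (-t * energy N q J β.card) * sgn α β := by
    rw [← Finset.sum_neg_distrib]
    refine Fintype.sum_equiv (Equiv.ofBijective _ compl_bijective) _ _ fun β => ?_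
    simp only [Equiv.ofBijective_apply]
    rw [energy_card_compl hq, sgn_compl_right, (Nat.not_even_iff_odd.mp hα).neg_one_pow]
    push_cast; ring
  rw [self_eq_neg.mp h, mul_zero]

end

section
/-! ### Majorana strings -/

variable {ι : Type*} {N : ℕ}

/-- Equality of operators up to a phase. -/
def PhaseEq (X Y : Matrix ι ι ℂ) : Prop := ∃ c : ℂ, ‖c‖ = 1 ∧ X = c • Y

namespace PhaseEq

lemma refl (X : Matrix ι ι ℂ) : PhaseEq X X := ⟨1, by simp, by simp⟩

lemma of_eq {X Y : Matrix ι ι ℂ} (h : X = Y) : PhaseEq X Y := h ▸ refl X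

lemma neg (X : Matrix ι ι ℂ) : PhaseEq (-X) X := ⟨-1, by simp, by simp⟩

lemma smul {c : ℂ} (hc : ‖c‖ = 1) (X : Matrix ι ι ℂ) : PhaseEq (c • X) X := ⟨c, hc, rfl⟩

lemma trans {X Y Z : Matrix ι ι ℂ} : PhaseEq X Y → PhaseEq Y Z → PhaseEq X Z := by
  rintro ⟨c, hc, rfl⟩ ⟨d, hd, rfl⟩
  exact ⟨c * d, by simp [hc, hd], smul_smul c d Z⟩

lemma symm {X Y : Matrix ι ι ℂ} : PhaseEq X Y → PhaseEq Y X := by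
  rintro ⟨c, hc, rfl⟩
  have h : c ≠ 0 := norm_ne_zero_iff.mp (by simp [hc])
  exact ⟨c⁻¹, by simp [hc], (inv_smul_smul₀ h Y).symm⟩

lemma mul [Fintype ι] {X Y X' Y' : Matrix ι ι ℂ} : PhaseEq X X' → PhaseEq Y Y' →
    PhaseEq (X * Y) (X' * Y') := by
  rintro ⟨c, hc, rfl⟩ ⟨d, hd, rfl⟩
  exact ⟨c * d, by simp [hc, hd], by rw [smul_mul_smul_comm]⟩

lemma norm_trace [Fintype ι] {X Y : Matrix ι ι ℂ} : PhaseEq X Y → ‖X.trace‖ = ‖Y.trace‖ := by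
  rintro ⟨c, hc, rfl⟩
  simp [hc]

end PhaseEq

lemma majString_empty [Fintype ι] [DecidableEq ι] (ψ : Fin N → Matrix ι ι ℂ) :
    majString ψ ∅ = 1 := by
  simp [majString]

namespace IsMajorana

variable [Fintype ι] [DecidableEq ι] {ψ : Fin N → Matrix ι ι ℂ} (hψ : IsMajorana ψ)
include hψ

lemma mul_self (i : Fin N) : ψ i * ψ i = 1 := by
  have h := hψ.anticomm i i
  rw [if_pos rfl, ← two_smul ℂ] at h
  have h2 : (2 : Matrix ι ι ℂ) = (2 : ℂ) • 1 := by rw [two_smul]; norm_num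
  rw [h2] at h
  exact smul_right_injective _ (two_ne_zero' ℂ) h

lemma mul_comm_of_ne {i j : Fin N} (h : i ≠ j) : ψ i * ψ j = -(ψ j * ψ i) := by
  have := hψ.anticomm i j
  rw [if_neg h] at this
  exact eq_neg_of_add_eq_zero_left this

lemma nonempty : Nonempty ι := by
  rw [← Fintype.card_pos_iff, hψ.card_eq]
  positivity

lemma phaseEq_prod_of_perm {l l' : List (Fin N)} (h : l.Perm l') :
    PhaseEq (l.map ψ).prod (l'.map ψ).prod := by
  induction h with
  | nil => exact .refl _
  | cons i _ ih => simpa using PhaseEq.mul (.refl (ψ i)) ih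
  | swap i j l =>
    simp only [List.map_cons, List.prod_cons, ← mul_assoc]
    refine PhaseEq.mul ?_ (.refl _)
    by_cases hij : j = i
    · rw [hij]; exact .refl _
    · rw [hψ.mul_comm_of_ne hij]; exact .neg _
  | trans _ _ h₁ h₂ => exact h₁.trans h₂

lemma phaseEq_mul_of_notMem {i : Fin N} {α : Finset (Fin N)} (hi : i ∉ α) :
    PhaseEq (ψ i * majString ψ α) (majString ψ (insert i α)) := by
  have h : (i :: α.sort (· ≤ ·)).Perm ((insert i α).sort (· ≤ ·)) := by
    refine (List.perm_ext_iff_of_nodup ?_ (Finset.sort_nodup _ _)).mpr fun j => by simp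
    simp [hi]
  simpa [majString] using hψ.phaseEq_prod_of_perm h

lemma phaseEq_mul_symmDiff (i : Fin N) (α : Finset (Fin N)) :
    PhaseEq (ψ i * majString ψ α) (majString ψ (symmDiff {i} α)) := by
  by_cases hi : i ∈ α
  · have h1 := hψ.phaseEq_mul_of_notMem (Finset.notMem_erase i α)
    rw [Finset.insert_erase hi] at h1
    have h2 : symmDiff {i} α = α.erase i := by
      ext j; by_cases hj : j = i <;> simp [Finset.mem_symmDiff, hj, hi]
    rw [h2]
    refine (PhaseEq.mul (.refl (ψ i)) h1.symm).trans ?_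
    rw [← mul_assoc, hψ.mul_self, one_mul]
    exact .refl _
  · have h2 : symmDiff {i} α = insert i α := by
      ext j; by_cases hj : j = i <;> simp [Finset.mem_symmDiff, hj, hi]
    rw [h2]
    exact hψ.phaseEq_mul_of_notMem hi

lemma majString_mul (α β : Finset (Fin N)) :
    PhaseEq (majString ψ α * majString ψ β) (majString ψ (symmDiff α β)) := by
  induction α using Finset.induction_on with
  | empty => 
    rw [majString_empty, one_mul, ← Finset.bot_eq_empty, bot_symmDiff]
    exact .refl _
  | insert i α hi ih =>
    have h2 : symmDiff {i} α = insert i α := by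
      ext j; by_cases hj : j = i <;> simp [Finset.mem_symmDiff, hj, hi]
    refine ((hψ.phaseEq_mul_of_notMem hi).symm.mul (.refl _)).trans ?_
    rw [mul_assoc, ← h2, symmDiff_assoc]
    exact (PhaseEq.mul (.refl _) ih).trans (hψ.phaseEq_mul_symmDiff i _)

lemma majString_mem_unitaryGroup (α : Finset (Fin N)) :
    majString ψ α ∈ unitaryGroup ι ℂ := by
  refine Submonoid.list_prod_mem _ fun X hX => ?_
  obtain ⟨i, -, rfl⟩ := List.mem_map.mp hX
  rw [mem_unitaryGroup_iff, star_eq_conjTranspose, (hψ.isHermitian i).eq, hψ.mul_self]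

/-- The sign counts the entries of the list that differ from `i`, hence anticommute with `ψ_i`. -/
lemma mul_prod_list (i : Fin N) (l : List (Fin N)) :
    ψ i * (l.map ψ).prod =
      (-1 : ℂ) ^ (l.filter (· ≠ i)).length • ((l.map ψ).prod * ψ i) := by
  induction l with
  | nil => simp
  | cons j l ih =>
    rw [List.map_cons, List.prod_cons, ← mul_assoc]
    by_cases hj : j = i
    · subst hj
      simp only [ne_eq, not_true_eq_false, decide_false, Bool.false_eq_true, not_false_eq_true,
        List.filter_cons_of_neg]
      conv_lhs => rw [mul_assoc, ih, mul_smul_comm, ← mul_assoc]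
    · rw [hψ.mul_comm_of_ne (Ne.symm hj), neg_mul, mul_assoc, ih,
        List.filter_cons_of_pos (by simpa), List.length_cons, pow_succ, mul_smul_comm, mul_assoc]
      simp

lemma mul_majString (i : Fin N) (α : Finset (Fin N)) :
    ψ i * majString ψ α = (-1 : ℂ) ^ (α.erase i).card • (majString ψ α * ψ i) := by
  have h : ((α.sort (· ≤ ·)).filter (· ≠ i)).length = (α.erase i).card := by
    rw [← List.toFinset_card_of_nodup ((Finset.sort_nodup _ _).filter _)]
    congr 1
    ext j; simp [and_comm]
  rw [majString, hψ.mul_prod_list, h]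

/-- A string that anticommutes with some `ψ_i` is traceless. -/
lemma trace_majString_eq_zero {i : Fin N} {α : Finset (Fin N)} (h : Odd (α.erase i).card) :
    (majString ψ α).trace = 0 := by
  have h1 : (majString ψ α).trace = -(majString ψ α).trace := by
    conv_lhs => rw [← one_mul (majString ψ α), ← hψ.mul_self i, mul_assoc, hψ.mul_majString,
      h.neg_one_pow, mul_smul_comm, trace_smul, trace_mul_comm, mul_assoc, hψ.mul_self]
    simp
  exact self_eq_neg.mp h1

lemma trace_majString_of_even {α : Finset (Fin N)} (h : Even α.card) (hα : α ≠ ∅) :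
    (majString ψ α).trace = 0 := by
  obtain ⟨i, hi⟩ := Finset.nonempty_iff_ne_empty.mpr hα
  refine hψ.trace_majString_eq_zero (i := i) ?_
  have := Finset.card_erase_add_one hi
  rw [← this] at h
  exact Nat.not_even_iff_odd.mp fun h' => (Nat.even_add_one.mp h) h'

lemma trace_majString_of_odd {α : Finset (Fin N)} (h : Odd α.card) (hα : α ≠ Finset.univ) :
    (majString ψ α).trace = 0 := by
  obtain ⟨i, hi⟩ : ∃ i, i ∉ α := by
    by_contra! h'; exact hα (Finset.eq_univ_iff_forall.mpr h')
  exact hψ.trace_majString_eq_zero (i := i) (by rwa [Finset.erase_eq_of_notMem hi])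

/-- Reordering a product of `s` distinct Majorana operators into its square takes `s (s - 1) / 2`
transpositions. -/
lemma prod_list_mul_self {l : List (Fin N)} (hl : l.Nodup) :
    (l.map ψ).prod * (l.map ψ).prod = (-1 : ℂ) ^ l.length.choose 2 • 1 := by
  induction l with
  | nil => simp
  | cons i l ih =>
    obtain ⟨hi, hl⟩ := List.nodup_cons.mp hl
    have h := hψ.mul_prod_list i l
    rw [List.filter_eq_self.mpr (by intro j hj; simpa using fun h : j = i => hi (h ▸ hj))] at h
    rw [List.map_cons, List.prod_cons]
    nth_rewrite 1 [h]
    rw [smul_mul_assoc, mul_assoc _ (ψ i), ← mul_assoc (ψ i), hψ.mul_self, one_mul, ih hl]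
    rw [smul_smul, ← pow_add, List.length_cons, Nat.choose_succ_succ' l.length 1,
      Nat.choose_one_right]

lemma majString_mul_self {q : ℕ} (hq : Even q) {α : Finset (Fin N)} (hα : α.card = q) :
    majString ψ α * majString ψ α = (-1 : ℂ) ^ (q / 2) • 1 := by
  rw [majString, hψ.prod_list_mul_self (Finset.sort_nodup _ _), Finset.length_sort, hα]
  obtain ⟨k, rfl⟩ := hq
  congr 1
  rw [Nat.choose_two_right, show (k + k) / 2 = k by omega,
    show (k + k) * (k + k - 1) / 2 = k * (k + k - 1) by
      rw [show (k + k) * (k + k - 1) = 2 * (k * (k + k - 1)) by ring]; simp]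
  rcases Nat.eq_zero_or_pos k with rfl | hk
  · simp
  · rw [mul_comm, pow_mul, Odd.neg_one_pow (⟨k - 1, by omega⟩)]

lemma phaseEq_conjTranspose (α : Finset (Fin N)) :
    PhaseEq (majString ψ α)ᴴ (majString ψ α) := by
  have h1 := mem_unitaryGroup_iff'.mp (hψ.majString_mem_unitaryGroup α)
  rw [star_eq_conjTranspose] at h1
  have h2 := (PhaseEq.refl (majString ψ α)ᴴ).mul (hψ.majString_mul α α).symm
  rw [symmDiff_self, Finset.bot_eq_empty, majString_empty, mul_one, ← mul_assoc, h1, one_mul] at h2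
  exact h2

end IsMajorana

lemma inv_sqrt_card_mul_self [Fintype ι] :
    (((Real.sqrt (Fintype.card ι))⁻¹ : ℝ) : ℂ) * (((Real.sqrt (Fintype.card ι))⁻¹ : ℝ) : ℂ) =
      (Fintype.card ι : ℂ)⁻¹ := by
  rw [← Complex.ofReal_mul, ← mul_inv, Real.mul_self_sqrt (by positivity)]; simp

lemma choi_dotProduct [Fintype ι] (A B : Matrix ι ι ℂ) :
    star (choi A) ⬝ᵥ choi B = (Fintype.card ι : ℂ)⁻¹ * (Aᴴ * B).trace := by
  simp only [dotProduct, Fintype.sum_prod_type, trace, diag, mul_apply, conjTranspose_apply,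
    Pi.star_apply, choi, star_mul']
  rw [Finset.sum_comm, Finset.mul_sum]
  refine Finset.sum_congr rfl fun i _ => ?_
  rw [Finset.mul_sum]
  refine Finset.sum_congr rfl fun j _ => ?_
  rw [← inv_sqrt_card_mul_self]
  simp only [RCLike.star_def, Complex.conj_ofReal]
  ring

lemma even_card_symmDiff {α β : Finset (Fin N)} :
    Even (symmDiff α β).card ↔ (Even α.card ↔ Even β.card) := by
  have h := sgn_symmDiff α β Finset.univ
  rw [sgn_comm, sgn_univ_left, sgn_comm, sgn_univ_left, sgn_comm β, sgn_univ_left] at h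
  rcases Nat.even_or_odd α.card with h1 | h1 <;> rcases Nat.even_or_odd β.card with h2 | h2 <;>
    rcases Nat.even_or_odd (symmDiff α β).card with h3 | h3 <;>
    simp [h1.neg_one_pow, h2.neg_one_pow, h3.neg_one_pow] at h <;>
    simp [h1, h2, h3, Nat.not_even_iff_odd.mpr]

namespace IsMajorana

variable [Fintype ι] [DecidableEq ι] {ψ : Fin N → Matrix ι ι ℂ} (hψ : IsMajorana ψ)
include hψ

lemma choi_dotProduct_self (α : Finset (Fin N)) :
    star (choi (majString ψ α)) ⬝ᵥ choi (majString ψ α) = 1 := by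
  have h1 := mem_unitaryGroup_iff'.mp (hψ.majString_mem_unitaryGroup α)
  rw [star_eq_conjTranspose] at h1
  have := hψ.nonempty
  rw [choi_dotProduct, h1, trace_one, inv_mul_cancel₀]
  exact_mod_cast Fintype.card_ne_zero

lemma choi_dotProduct_eq_zero {α β : Finset (Fin N)}
    (h : (majString ψ (symmDiff α β)).trace = 0) :
    star (choi (majString ψ α)) ⬝ᵥ choi (majString ψ β) = 0 := by
  have h1 := (((hψ.phaseEq_conjTranspose α).mul (.refl _)).trans (hψ.majString_mul α β)).norm_trace
  rw [h, norm_zero, norm_eq_zero] at h1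
  rw [choi_dotProduct, h1, mul_zero]

/-- The Choi states of the strings of even length are orthonormal: the product of two different
such strings is, up to a phase, a non-trivial string of even length, and hence traceless. -/
lemma choi_orthonormal {α β : Finset (Fin N)} (hα : Even α.card) (hβ : Even β.card) :
    star (choi (majString ψ α)) ⬝ᵥ choi (majString ψ β) = if α = β then 1 else 0 := by
  split_ifs with h
  · rw [← h, hψ.choi_dotProduct_self]
  · exact hψ.choi_dotProduct_eq_zero (hψ.trace_majString_of_even
      (even_card_symmDiff.mpr (by simp [hα, hβ])) (fun h' => h (symmDiff_eq_empty.mp h')))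

end IsMajorana

lemma two_mul_sum_even (f : Finset (Fin N) → ℤ) :
    2 * ∑ γ : Finset (Fin N) with Even γ.card, f γ = ∑ γ, (1 + sgn Finset.univ γ) * f γ := by
  rw [Finset.sum_filter, Finset.mul_sum]
  refine Finset.sum_congr rfl fun γ _ => ?_
  rw [sgn_univ_left]
  split_ifs with h
  · rw [h.neg_one_pow]; ring
  · rw [(Nat.not_even_iff_odd.mp h).neg_one_pow]; ring

lemma sum_even_sgn (α : Finset (Fin N)) :
    2 * ∑ γ : Finset (Fin N) with Even γ.card, sgn γ α =
      (if α = ∅ then 2 ^ N else 0) + if α = Finset.univ then 2 ^ N else 0 := by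
  rw [two_mul_sum_even]
  simp only [add_mul, one_mul, Finset.sum_add_distrib, fun γ => sgn_comm γ α, sum_sgn,
    sum_sgn_mul_sgn, @eq_comm _ Finset.univ α]

/-- The number of even strings; it equals the dimension of the operator space when `N` is odd. -/
lemma card_even (hN : N ≠ 0) :
    Fintype.card {γ : Finset (Fin N) // Even γ.card} = 2 ^ (N - 1) := by
  have h := sum_even_sgn (N := N) ∅
  have : Nonempty (Fin N) := ⟨⟨0, Nat.pos_of_ne_zero hN⟩⟩
  rw [if_pos rfl, if_neg (Finset.univ_nonempty.ne_empty.symm)] at h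
  simp only [sgn_empty_right, Finset.sum_const, nsmul_eq_mul, mul_one, add_zero] at h
  rw [Fintype.card_subtype]
  obtain ⟨n, rfl⟩ := Nat.exists_eq_succ_of_ne_zero hN
  rw [Nat.succ_sub_one]
  rw [pow_succ, mul_comm] at h
  exact_mod_cast mul_right_cancel₀ (two_ne_zero) h

namespace IsMajorana

variable [Fintype ι] [DecidableEq ι] {ψ : Fin N → Matrix ι ι ℂ} (hψ : IsMajorana ψ)
include hψ

lemma card_sq_of_even (hN : Even N) : Fintype.card ι ^ 2 = 2 ^ N := by
  rw [hψ.card_eq, ← pow_mul, Nat.div_mul_cancel hN.two_dvd]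

lemma card_sq_of_odd (hN : Odd N) : Fintype.card ι ^ 2 = 2 ^ (N - 1) := by
  rw [hψ.card_eq, ← pow_mul]
  congr 1
  obtain ⟨k, rfl⟩ := hN
  omega

/-- For `N` even only the empty string has a trace; the right-hand side is the indicator function of
`α = ∅`, times `2 ^ N = d²`. -/
lemma sq_norm_trace_of_even (hN : Even N) (α : Finset (Fin N)) :
    ‖(majString ψ α).trace‖ ^ 2 = ((∑ γ, sgn γ α : ℤ) : ℝ) := by
  simp only [fun γ => sgn_comm γ α, sum_sgn]
  split_ifs with h
  · rw [h, majString_empty, trace_one, Complex.norm_natCast]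
    exact_mod_cast hψ.card_sq_of_even hN
  · rcases Nat.even_or_odd α.card with h1 | h1
    · simp [hψ.trace_majString_of_even h1 h]
    · have hne : α ≠ Finset.univ := by
        rintro rfl
        rw [Finset.card_univ, Fintype.card_fin] at h1
        exact Nat.not_even_iff_odd.mpr h1 hN
      simp [hψ.trace_majString_of_odd h1 hne]

/-- For `N` odd, the product of all Majorana operators is a scalar: the even strings form an
orthonormal basis, and all of them but the empty one are orthogonal to it. -/
lemma sq_norm_trace_univ (hN : Odd N) :
    ‖(majString ψ Finset.univ).trace‖ ^ 2 = 2 ^ (N - 1) := by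
  have hN0 : N ≠ 0 := by rintro rfl; simp at hN
  let v : {γ : Finset (Fin N) // Even γ.card} → EuclideanSpace ℂ (ι × ι) :=
    fun γ => WithLp.toLp 2 (choi (majString ψ γ.1))
  let w : EuclideanSpace ℂ (ι × ι) := WithLp.toLp 2 (choi (majString ψ Finset.univ))
  have hinner : ∀ A B : Matrix ι ι ℂ,
      inner ℂ (WithLp.toLp 2 (choi A) : EuclideanSpace ℂ (ι × ι)) (WithLp.toLp 2 (choi B)) =
        star (choi A) ⬝ᵥ choi B := by
    intro A B
    rw [EuclideanSpace.inner_toLp_toLp, dotProduct_comm]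
  have hv : Orthonormal ℂ v := by
    rw [orthonormal_iff_ite]
    intro α β
    rw [hinner, hψ.choi_orthonormal α.2 β.2]
    simp [Subtype.ext_iff]
  have hcard : Fintype.card {γ : Finset (Fin N) // Even γ.card} =
      Module.finrank ℂ (EuclideanSpace ℂ (ι × ι)) := by
    rw [finrank_euclideanSpace, Fintype.card_prod, ← sq, hψ.card_sq_of_odd hN, card_even hN0]
  have : Nonempty {γ : Finset (Fin N) // Even γ.card} := ⟨⟨∅, by simp⟩⟩
  let b := (basisOfOrthonormalOfCardEqFinrank hv hcard).toOrthonormalBasis (by simpa using hv)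
  have hb : ∀ γ, b γ = v γ := fun γ => by simp [b]
  have hsum := b.sum_sq_norm_inner_right w
  have hw : ‖w‖ ^ 2 = 1 := by
    have : (inner ℂ w w : ℂ) = 1 := by rw [hinner, hψ.choi_dotProduct_self]
    rw [← inner_self_eq_norm_sq (𝕜 := ℂ), this]
    simp
  rw [hw, Finset.sum_eq_single ⟨∅, by simp⟩, hb, hinner, choi_dotProduct, majString_empty] at hsum
  · simp only [conjTranspose_one, one_mul, norm_mul, norm_inv, Complex.norm_natCast,
      mul_pow] at hsum
    have h1 : ((Fintype.card ι : ℝ)) ^ 2 = 2 ^ (N - 1) := by exact_mod_cast hψ.card_sq_of_odd hN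
    rw [inv_pow, h1] at hsum
    field_simp at hsum
    exact hsum
  · intro γ _ hγ
    rw [hb, hinner, hψ.choi_dotProduct_eq_zero]
    · simp
    · refine hψ.trace_majString_of_odd ?_ fun h => hγ ?_
      · rw [← Nat.not_even_iff_odd, even_card_symmDiff]
        simp [γ.2, hN]
      · have h1 := congrArg (symmDiff · Finset.univ) h
        simp only [symmDiff_symmDiff_cancel_right, symmDiff_self] at h1
        exact Subtype.ext h1
  · simp

/-- For `N` odd only the empty and the full string have a trace; the right-hand side is the
indicator function of `α = ∅` or `α = univ`, times `2 ^ (N - 1) = d²`. -/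
lemma sq_norm_trace_of_odd (hN : Odd N) (α : Finset (Fin N)) :
    ‖(majString ψ α).trace‖ ^ 2 =
      ((∑ γ : Finset (Fin N) with Even γ.card, sgn γ α : ℤ) : ℝ) := by
  have hN0 : N ≠ 0 := by rintro rfl; simp at hN
  have : Nonempty (Fin N) := ⟨⟨0, Nat.pos_of_ne_zero hN0⟩⟩
  have hne : (Finset.univ : Finset (Fin N)) ≠ ∅ := Finset.univ_nonempty.ne_empty
  have hpow : (2 : ℝ) * 2 ^ (N - 1) = 2 ^ N := by
    rw [← pow_succ', Nat.sub_add_cancel (Nat.pos_of_ne_zero hN0)]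
  refine mul_left_cancel₀ (two_ne_zero' ℝ) ?_
  have h := congrArg (Int.cast (R := ℝ)) (sum_even_sgn α)
  rw [Int.cast_mul] at h
  refine Eq.trans ?_ h.symm
  by_cases h0 : α = ∅
  · rw [if_pos h0, if_neg (h0 ▸ hne.symm), h0, majString_empty, trace_one, Complex.norm_natCast]
    push_cast
    rw [add_zero, ← hpow]
    congr 1
    exact_mod_cast hψ.card_sq_of_odd hN
  by_cases h1 : α = Finset.univ
  · rw [if_neg h0, if_pos h1, h1, hψ.sq_norm_trace_univ hN, hpow]
    push_cast; ring
  · rw [if_neg h0, if_neg h1]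
    rcases Nat.even_or_odd α.card with h2 | h2
    · simp [hψ.trace_majString_of_even h2 h0]
    · simp [hψ.trace_majString_of_odd h2 h1]

end IsMajorana

end

section
/-! ### Doubled operators -/

/-- Continuous homomorphisms from a Banach algebra to a topological algebra preserve the
exponential; no norm on the target is involved. -/
lemma map_exp_of_continuous {A B : Type*} [NormedRing A] [NormedAlgebra ℂ A] [CompleteSpace A]
    [Ring B] [Algebra ℂ B] [TopologicalSpace B] [IsTopologicalRing B] [T2Space B] (f : A →+* B)
    (hf : Continuous f) (a : A) :
    f (NormedSpace.exp a) = NormedSpace.exp (f a) := by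
  have h := (NormedSpace.exp_series_hasSum_exp' (𝕂 := ℂ) a).map f hf
  rw [NormedSpace.exp_eq_tsum ℂ (𝔸 := B), ← h.tsum_eq]
  exact tsum_congr fun n => by
    rw [Function.comp_apply, map_inv_natCast_smul f ℂ ℂ, map_pow]

/-- The operator `U ⊗ U*` on a replica and its conjugate, as a multiplicative map. -/
def doubled {ι : Type*} [Fintype ι] [DecidableEq ι] :
    Matrix ι ι ℂ →* Matrix (ι × ι) (ι × ι) ℂ where
  toFun U := U ⊗ₖ U.map star
  map_one' := by
    rw [Matrix.map_one _ (star_zero _) (star_one _), one_kronecker_one]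
  map_mul' U V := by
    rw [← mul_kronecker_mul]
    congr 1
    exact Matrix.map_mul (f := starRingEnd ℂ)

variable {ι : Type*} [Fintype ι] [DecidableEq ι] {N : ℕ}

lemma doubled_apply (U : Matrix ι ι ℂ) : doubled U = U ⊗ₖ U.map star := rfl

/-- A phase cancels between an operator and its complex conjugate. -/
lemma PhaseEq.doubled_eq {X Y : Matrix ι ι ℂ} : PhaseEq X Y → doubled X = doubled Y := by
  rintro ⟨c, hc, rfl⟩
  have h : c * star c = 1 := by
    rw [RCLike.star_def, Complex.mul_conj, Complex.normSq_eq_norm_sq, hc]; simp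
  ext ⟨i, j⟩ ⟨k, l⟩
  simp only [doubled_apply, kronecker_apply, Matrix.smul_apply, map_apply, smul_eq_mul, star_mul']
  linear_combination (Y i k * star (Y j l)) * h

/-- The Fourier transform of a function on the subsets of `Fin N`, with respect to `sgn`. -/
def fourier (f : Finset (Fin N) → ℂ) (α : Finset (Fin N)) : ℂ :=
  (2 ^ N : ℂ)⁻¹ * ∑ β, f β * sgn α β

lemma sum_sgn_mul_sgn_complex (α β : Finset (Fin N)) :
    ∑ γ, (sgn α γ : ℂ) * sgn β γ = if α = β then 2 ^ N else 0 := by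
  have := congrArg (Int.cast (R := ℂ)) (sum_sgn_mul_sgn α β)
  push_cast at this
  exact this

lemma fourier_sgn (α β : Finset (Fin N)) :
    fourier (fun γ => (sgn α γ : ℂ)) β = if α = β then 1 else 0 := by
  rw [fourier, sum_sgn_mul_sgn_complex]
  split_ifs <;> simp

/-- The Fourier transform turns products into convolutions. -/
lemma fourier_mul (f g : Finset (Fin N) → ℂ) (δ : Finset (Fin N)) :
    fourier (f * g) δ = ∑ α, fourier f α * fourier g (symmDiff α δ) := by
  have h : ∀ α, fourier f α * fourier g (symmDiff α δ) =
      ∑ β, ∑ γ, ((2 ^ N : ℂ)⁻¹ * (2 ^ N : ℂ)⁻¹ * (f β * g γ * sgn δ γ)) *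
        ((sgn β α : ℂ) * sgn γ α) := by
    intro α
    rw [fourier, fourier, mul_mul_mul_comm, Finset.sum_mul_sum, Finset.mul_sum]
    refine Finset.sum_congr rfl fun β _ => ?_
    rw [Finset.mul_sum]
    refine Finset.sum_congr rfl fun γ _ => ?_
    rw [sgn_symmDiff, sgn_comm β, sgn_comm γ α]
    push_cast; ring
  simp only [h]
  rw [Finset.sum_comm, fourier, Finset.mul_sum]
  refine Finset.sum_congr rfl fun β _ => ?_
  rw [Finset.sum_comm]
  simp only [← Finset.mul_sum, sum_sgn_mul_sgn_complex]
  simp only [Pi.mul_apply, mul_ite, mul_zero, Finset.sum_ite_eq, Finset.mem_univ, if_true]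
  field_simp

namespace IsMajorana

variable {ψ : Fin N → Matrix ι ι ℂ} (hψ : IsMajorana ψ)

include hψ in
/-- The doubled strings represent the group of subsets under symmetric difference. -/
lemma doubled_mul (α β : Finset (Fin N)) :
    doubled (majString ψ α) * doubled (majString ψ β) =
      doubled (majString ψ (symmDiff α β)) := by
  rw [← map_mul]
  exact (hψ.majString_mul α β).doubled_eq

/-- The functional calculus of the commuting doubled strings: a function on their joint spectrum,
which is the dual group, is sent to the corresponding operator. -/
def calculus : (Finset (Fin N) → ℂ) →+* Matrix (ι × ι) (ι × ι) ℂ where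
  toFun f := ∑ α, fourier f α • doubled (majString ψ α)
  map_zero' := by simp [fourier]
  map_add' f g := by
    simp only [fourier, Pi.add_apply, add_mul, mul_add, Finset.sum_add_distrib, add_smul]
  map_one' := by
    have h : (1 : Finset (Fin N) → ℂ) = fun γ => (sgn ∅ γ : ℂ) := by ext; simp
    rw [h]
    simp only [fourier_sgn, ite_smul, one_smul, zero_smul, Finset.sum_ite_eq, Finset.mem_univ,
      if_true, majString_empty, map_one]
  map_mul' f g := by
    rw [Finset.sum_mul_sum]
    simp only [smul_mul_smul_comm, hψ.doubled_mul]
    have h : ∀ α, ∑ β, (fourier f α * fourier g β) • doubled (majString ψ (symmDiff α β)) =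
        ∑ δ, (fourier f α * fourier g (symmDiff α δ)) • doubled (majString ψ δ) := by
      intro α
      refine Fintype.sum_equiv ⟨symmDiff α, symmDiff α, symmDiff_symmDiff_cancel_left α,
        symmDiff_symmDiff_cancel_left α⟩ _ _ fun β => ?_
      simp only [Equiv.coe_fn_mk, symmDiff_symmDiff_cancel_left]
    simp only [h]
    rw [Finset.sum_comm]
    simp only [← Finset.sum_smul, fourier_mul]

lemma calculus_apply (f : Finset (Fin N) → ℂ) :
    hψ.calculus f = ∑ α, fourier f α • doubled (majString ψ α) := rfl

lemma continuous_calculus : Continuous hψ.calculus := by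
  change Continuous fun f => ∑ α, fourier f α • doubled (majString ψ α)
  unfold fourier
  fun_prop

lemma calculus_smul (c : ℂ) (f : Finset (Fin N) → ℂ) :
    hψ.calculus (c • f) = c • hψ.calculus f := by
  simp only [calculus_apply, Finset.smul_sum, smul_smul]
  refine Finset.sum_congr rfl fun α _ => ?_
  congr 1
  simp only [fourier, Pi.smul_apply, smul_eq_mul, mul_assoc, ← Finset.mul_sum]
  ring

lemma calculus_sgn (α : Finset (Fin N)) :
    hψ.calculus (fun γ => (sgn α γ : ℂ)) = doubled (majString ψ α) := by
  simp [calculus_apply, fourier_sgn]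

include hψ in
/-- The squares in the effective Hamiltonian, multiplied out. -/
lemma Heff_eq {q : ℕ} (hq : Even q) (J : ℝ) :
    Heff ψ q J = (J : ℂ) • ∑ α : Strings N q, (1 - doubled (majString ψ α.1)) := by
  have hI : Complex.I ^ q = (-1) ^ (q / 2) := by
    rw [← Complex.I_sq, ← pow_mul, Nat.mul_div_cancel' hq.two_dvd]
  have hε : ((-1 : ℂ) ^ (q / 2)) * (-1) ^ (q / 2) = 1 := by rw [← mul_pow]; simp
  have hsq : ∀ α : Strings N q,
      (majString ψ α.1 ⊗ₖ (1 : Matrix ι ι ℂ)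
        - (-1 : ℂ) ^ (q / 2) • ((1 : Matrix ι ι ℂ) ⊗ₖ (majString ψ α.1).map star)) ^ 2 =
      (2 * (-1 : ℂ) ^ (q / 2)) • (1 - doubled (majString ψ α.1)) := by
    intro α
    have h1 := hψ.majString_mul_self hq α.2
    have h2 : (majString ψ α.1).map star * (majString ψ α.1).map star =
        (-1 : ℂ) ^ (q / 2) • 1 := by
      have h3 : ((majString ψ α.1) * (majString ψ α.1)).map star =
          (majString ψ α.1).map star * (majString ψ α.1).map star :=
        Matrix.map_mul (f := starRingEnd ℂ)
      rw [← h3, h1]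
      ext i j
      by_cases h : i = j <;> simp [h]
    rw [sq, sub_mul, mul_sub, mul_sub]
    simp only [smul_mul_assoc, mul_smul_comm, ← mul_kronecker_mul, one_mul, mul_one, h1, h2,
      smul_kronecker, kronecker_smul, one_kronecker_one, ← doubled_apply, smul_smul]
    generalize (-1 : ℂ) ^ (q / 2) = ε at hε ⊢
    have h4 : ε * (ε * ε) = ε := by rw [hε, mul_one]
    rw [h4]
    module
  rw [Heff]
  simp only [hsq, ← Finset.smul_sum, smul_smul, hI]
  congr 1
  push_cast
  linear_combination (J : ℂ) * hε

/-- The effective Hamiltonian takes the value `E(|β|)` on the character of `β`. -/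
lemma calculus_energy {q : ℕ} (hq : Even q) (J : ℝ) :
    hψ.calculus (fun β => (energy N q J β.card : ℂ)) = Heff ψ q J := by
  have h : (fun β : Finset (Fin N) => (energy N q J β.card : ℂ)) =
      (J : ℂ) • ∑ α : Strings N q, (1 - fun β => (sgn α.1 β : ℂ)) := by
    ext β
    rw [energy_card]
    simp
  rw [h, calculus_smul, map_sum, hψ.Heff_eq hq]
  simp only [map_sub, map_one, calculus_sgn]

include hψ in
/-- `e^{-t H_eff}` is diagonal in the doubled strings, with coefficients the `λ_t`. -/
lemma exp_Heff {q : ℕ} (hq : Even q) (J t : ℝ) :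
    NormedSpace.exp (-(t : ℂ) • Heff ψ q J) =
      ∑ α : Finset (Fin N), (eigval N q J t α.card : ℂ) • doubled (majString ψ α) := by
  rw [← hψ.calculus_energy hq, ← calculus_smul,
    ← map_exp_of_continuous hψ.calculus hψ.continuous_calculus, calculus_apply]
  refine Finset.sum_congr rfl fun α _ => ?_
  congr 1
  rw [fourier, eigval_card]
  push_cast
  rw [one_div]
  congr 1
  refine Finset.sum_congr rfl fun β _ => ?_
  rw [Pi.coe_exp, ← Complex.exp_eq_exp_ℂ]
  simp

end IsMajorana

/-! ### Realignment -/

/-- The realignment of an operator on a replica and its conjugate, normalised by the dimension: it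
sends `U ⊗ U*` to `|U⟩⟨U|`. -/
def realign (P : Matrix (ι × ι) (ι × ι) ℂ) : Matrix (ι × ι) (ι × ι) ℂ :=
  fun p p' => (Fintype.card ι : ℂ)⁻¹ * P (p.1, p'.1) (p.2, p'.2)

lemma realign_doubled (U : Matrix ι ι ℂ) :
    realign (doubled U) = vecMulVec (choi U) (star (choi U)) := by
  ext p p'
  simp only [realign, doubled_apply, kronecker_apply, map_apply, vecMulVec_apply, choi,
    Pi.star_apply, star_mul', RCLike.star_def, Complex.conj_ofReal]
  rw [← inv_sqrt_card_mul_self]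
  ring

/-- The realignment of `e^{-t H_eff}` is `ρ_t`; the odd strings drop out since `λ_t` vanishes at
odd lengths. -/
lemma IsMajorana.realign_exp_Heff {ψ : Fin N → Matrix ι ι ℂ} (hψ : IsMajorana ψ) {q : ℕ}
    (hq : Even q) (J t : ℝ) :
    realign (NormedSpace.exp (-(t : ℂ) • Heff ψ q J)) = rho ψ q J t := by
  rw [hψ.exp_Heff hq, rho, Finset.sum_filter]
  have h : ∀ α : Finset (Fin N), (if Even α.card then (eigval N q J t α.card : ℂ) •
      vecMulVec (choi (majString ψ α)) (star (choi (majString ψ α))) else 0) =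
      (eigval N q J t α.card : ℂ) • realign (doubled (majString ψ α)) := by
    intro α
    split_ifs with hα
    · rw [realign_doubled]
    · rw [eigval_card_eq_zero_of_odd hq J t hα]; simp
  simp only [h]
  ext p p'
  simp only [realign, Matrix.sum_apply, Matrix.smul_apply, smul_eq_mul, Finset.mul_sum]
  exact Finset.sum_congr rfl fun α _ => by ring

/-! ### The spectrum of `ρ_t` -/

namespace IsMajorana

variable {ψ : Fin N → Matrix ι ι ℂ} (hψ : IsMajorana ψ)
include hψ

lemma rho_mulVec (q : ℕ) (J t : ℝ) {α : Finset (Fin N)} (hα : Even α.card) :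
    (rho ψ q J t).mulVec (choi (majString ψ α)) =
      (eigval N q J t α.card : ℂ) • choi (majString ψ α) := by
  rw [rho, sum_mulVec, Finset.sum_eq_single α]
  · rw [smul_mulVec, vecMulVec_mulVec, hψ.choi_dotProduct_self]
    simp
  · intro β hβ hne
    rw [smul_mulVec, vecMulVec_mulVec, hψ.choi_orthonormal (Finset.mem_filter.mp hβ).2 hα,
      if_neg hne]
    simp
  · intro h; simp [hα] at h

lemma rho_pow (q : ℕ) (J t : ℝ) {n : ℕ} (hn : 1 ≤ n) :
    rho ψ q J t ^ n = ∑ α : Finset (Fin N) with Even α.card,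
      ((eigval N q J t α.card ^ n : ℝ) : ℂ) •
        vecMulVec (choi (majString ψ α)) (star (choi (majString ψ α))) := by
  induction n, hn using Nat.le_induction with
  | base => simp [rho]
  | succ n _ ih =>
    rw [pow_succ', ih, Finset.mul_sum]
    refine Finset.sum_congr rfl fun α hα => ?_
    rw [mul_smul_comm, mul_vecMulVec, hψ.rho_mulVec q J t (Finset.mem_filter.mp hα).2,
      smul_vecMulVec, smul_smul]
    congr 1
    push_cast; ring

lemma trace_rho_pow (q : ℕ) (J t : ℝ) {n : ℕ} (hn : 1 ≤ n) :
    (rho ψ q J t ^ n).trace =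
      ((∑ α : Finset (Fin N) with Even α.card, eigval N q J t α.card ^ n : ℝ) : ℂ) := by
  rw [hψ.rho_pow q J t hn, trace_sum]
  push_cast
  refine Finset.sum_congr rfl fun α _ => ?_
  rw [trace_smul, trace_vecMulVec, dotProduct_comm, hψ.choi_dotProduct_self]
  simp

end IsMajorana

lemma sum_even_card (f : ℕ → ℝ) :
    ∑ α : Finset (Fin N) with Even α.card, f α.card =
      ∑ s ∈ Finset.range (N + 1) with Even s, (N.choose s : ℝ) * f s := by
  have h := Finset.sum_powerset_apply_card (fun s => if Even s then f s else 0)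
    (x := (Finset.univ : Finset (Fin N)))
  rw [Finset.powerset_univ, Finset.card_univ, Fintype.card_fin] at h
  rw [Finset.sum_filter, h, Finset.sum_filter]
  exact Finset.sum_congr rfl fun s _ => by simp

/-! ### Cyclic contractions -/

section Cyclic

variable {κ : Type*} [Fintype κ] [DecidableEq κ]

/-- Powers of a matrix as sums over paths, weighted by a function of the two endpoints. -/
lemma sum_path_prod {m : ℕ} (R : Matrix κ κ ℂ) (g : κ → κ → ℂ) :
    ∑ p : Fin (m + 1) → κ, (∏ a : Fin m, R (p a.castSucc) (p a.succ)) * g (p 0) (p (Fin.last m)) =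
      ∑ i, ∑ j, (R ^ m) i j * g i j := by
  induction m generalizing g with
  | zero =>
    rw [← (Equiv.funUnique (Fin 1) κ).symm.sum_comp]
    simp [Matrix.one_apply]
  | succ m ih =>
    rw [← (Fin.consEquiv fun _ => κ).sum_comp, Fintype.sum_prod_type]
    refine Finset.sum_congr rfl fun i _ => ?_
    have h := ih fun k l => R i k * g i l
    simp only [Fin.prod_univ_succ (n := m), Fin.consEquiv_apply, ← Fin.succ_last, Fin.cons_succ,
      Fin.cons_zero, Fin.castSucc_zero, ← Fin.succ_castSucc]
    calc _ = _ := Finset.sum_congr rfl fun p _ => by ring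
      _ = _ := h
      _ = _ := by
        rw [Finset.sum_comm]
        refine Finset.sum_congr rfl fun j _ => ?_
        rw [pow_succ', mul_apply, Finset.sum_mul]
        exact Finset.sum_congr rfl fun k _ => by ring

lemma sum_cycle_prod {n : ℕ} (hn : 1 ≤ n) (R : Matrix κ κ ℂ) :
    ∑ p : Fin n → κ, ∏ a, R (p a) (p (finRotate n a)) = (R ^ n).trace := by
  obtain ⟨m, rfl⟩ := Nat.exists_eq_add_of_le' hn
  have h := sum_path_prod (m := m) R fun i j => R j i
  have h1 : ∀ a : Fin m, finRotate (m + 1) a.castSucc = a.succ := fun a => by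
    rw [finRotate_apply]; simp
  simp only [Fin.prod_univ_castSucc, h1, finRotate_last]
  rw [h, pow_succ, trace]
  simp only [diag, mul_apply]

lemma sum_cycle_prod' {n : ℕ} (hn : 1 ≤ n) (R : Matrix κ κ ℂ) :
    ∑ p : Fin n → κ, ∏ a, R (p (finRotate n a)) (p a) = (R ^ n).trace := by
  have h := sum_cycle_prod hn Rᵀ
  rwa [← transpose_pow, trace_transpose] at h

end Cyclic

/-- The support of `|σ⟩`: the labels of the replicas `a‾` are determined by those of the
replicas `a`. -/
lemma permState_eq (n : ℕ) (σ : Equiv.Perm (Fin n)) (i k : Fin n → ι) :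
    permState n σ (fun a => (i a, k a)) =
      if k = i ∘ σ.symm then (((Real.sqrt (Fintype.card ι))⁻¹ : ℝ) : ℂ) ^ n else 0 := by
  simp only [permState, choi]
  rw [Finset.prod_mul_distrib, Finset.prod_const, Finset.card_univ, Fintype.card_fin]
  have hiff : k = i ∘ σ.symm ↔ ∀ a, i a = k (σ a) := by
    constructor
    · rintro rfl a; simp
    · intro h; ext b; simp [h]
  split_ifs with h
  · rw [hiff] at h
    rw [Finset.prod_eq_one fun a _ => ?_, mul_one]
    change (1 : Matrix ι ι ℂ) (i a) (k (σ a)) = 1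
    rw [h a, Matrix.one_apply_eq]
  · rw [hiff] at h
    push Not at h
    obtain ⟨a, ha⟩ := h
    rw [Finset.prod_eq_zero (Finset.mem_univ a) (by simp [ha]), mul_zero]

/-- The permutation states on both sides link the labels `a` and `η(a)‾`; grouping row and column
labels of each replica then turns the matrix element into a cyclic contraction. -/
lemma replicaMoment_eq (ψ : Fin N → Matrix ι ι ℂ) (q : ℕ) {n : ℕ} (hn : 1 ≤ n) (J t : ℝ) :
    replicaMoment ψ q n J t =
      (realign (NormedSpace.exp (-(t : ℂ) • Heff ψ q J)) ^ n).trace := by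
  set P := NormedSpace.exp (-(t : ℂ) • Heff ψ q J) with hP
  have hsplit : ∀ F : (Fin n → ι × ι) → ℂ,
      ∑ x, F x = ∑ i : Fin n → ι, ∑ k : Fin n → ι, F fun a => (i a, k a) := by
    intro F
    rw [← (Equiv.arrowProdEquivProdArrow (Fin n) (fun _ => ι) (fun _ => ι)).symm.sum_comp,
      Fintype.sum_prod_type]
    rfl
  set σ := finRotate n with hσ
  set c : ℂ := (((Real.sqrt (Fintype.card ι))⁻¹ : ℝ) : ℂ) ^ n with hc
  have hcc : star c * c = ∏ _a : Fin n, (Fintype.card ι : ℂ)⁻¹ := by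
    rw [Finset.prod_const, Finset.card_univ, Fintype.card_fin, ← inv_sqrt_card_mul_self, mul_pow,
      hc, star_pow]
    simp
  have h1 : replicaMoment ψ q n J t = ∑ i : Fin n → ι, ∑ j : Fin n → ι,
      ∏ a, realign P (i a, j a) (i (σ.symm a), j (σ.symm a)) := by
    unfold replicaMoment
    simp only [← hP, ← hσ]
    simp only [hsplit, permState_eq, ← hc]
    refine Finset.sum_congr rfl fun i _ => ?_
    rw [Finset.sum_eq_single (i ∘ σ.symm)]
    · refine Finset.sum_congr rfl fun j _ => ?_
      rw [Finset.sum_eq_single (j ∘ σ.symm)]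
      · simp only [if_true, realign, Finset.prod_mul_distrib, ← hcc, Function.comp_apply]
        ring
      · intro b _ hb; simp [hb]
      · simp
    · intro b _ hb; simp [hb]
    · simp
  rw [h1, ← sum_cycle_prod' hn, hsplit]
  refine Finset.sum_congr rfl fun i _ => Finset.sum_congr rfl fun j _ => ?_
  rw [← Equiv.prod_comp σ]
  simp only [Equiv.symm_apply_apply]
  rfl

end

section
/-! ### Sums over Majorana strings and parities -/

variable {N : ℕ}

/-- For `N = 0` the empty set is its own complement, so no choice of representatives exists. -/
lemma IsHalf.ne_zero {A : Finset (Finset (Fin N))} (hA : IsHalf A) : N ≠ 0 := by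
  rintro rfl
  have h := hA.xor_compl ∅
  rw [show (∅ᶜ : Finset (Fin 0)) = ∅ from Subsingleton.elim _ _] at h
  exact (xor_self _).mp h

lemma IsHalf.sum_eq {A : Finset (Finset (Fin N))} (hA : IsHalf A) {f : Finset (Fin N) → ℝ}
    (hf : ∀ β, f βᶜ = f β) : ∑ β, f β = 2 * ∑ β ∈ A, f β := by
  have h : ∑ β ∈ Aᶜ, f β = ∑ β ∈ A, f β := by
    refine Finset.sum_bij' (fun β _ => βᶜ) (fun β _ => βᶜ) ?_ ?_ (by simp) (by simp)
      (fun β _ => (hf β).symm)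
    · intro β hβ
      have := hA.xor_compl β
      rcases this with h | h
      · exact absurd h.1 (Finset.mem_compl.mp hβ)
      · exact h.1
    · intro β hβ
      rw [Finset.mem_compl]
      rcases hA.xor_compl β with h | h
      · exact h.2
      · exact absurd hβ h.2
  rw [← Finset.sum_add_sum_compl A, h, two_mul]

lemma eigval_card_eq_half {q : ℕ} (hq : Even q) (J t : ℝ) {A : Finset (Finset (Fin N))}
    (hA : IsHalf A) {γ : Finset (Fin N)} (hγ : Even γ.card) :
    eigval N q J t γ.card =
      1 / 2 ^ (N - 1) * ∑ β ∈ A, Real.exp (-t * energy N q J β.card) * sgn γ β := by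
  rw [eigval_card, hA.sum_eq]
  · have h : (2 : ℝ) ^ N = 2 * 2 ^ (N - 1) := by
      rw [← pow_succ', Nat.sub_add_cancel (Nat.pos_of_ne_zero hA.ne_zero)]
    rw [h]
    field_simp
  · intro β
    rw [energy_card_compl hq, sgn_compl_right, hγ.neg_one_pow, one_mul]

/-- The expansion of `λ_t(|γ|)ⁿ` over `n`-tuples of characters, with one representative from each
complementary pair: both have the same energy and, at even `γ`, the same value. -/
lemma sum_eigval_pow {q : ℕ} (hq : Even q) (J t : ℝ) {A : Finset (Finset (Fin N))}
    (hA : IsHalf A) (n : ℕ) :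
    ∑ γ : Finset (Fin N) with Even γ.card, eigval N q J t γ.card ^ n =
      1 / 2 ^ (n * (N - 1)) * ∑ α ∈ Fintype.piFinset fun _ : Fin n => A,
        Real.exp (-t * ∑ a, energy N q J (α a).card) *
          ((∑ γ : Finset (Fin N) with Even γ.card, ∏ a, sgn γ (α a) : ℤ) : ℝ) := by
  have h : ∀ γ : Finset (Fin N), Even γ.card → eigval N q J t γ.card ^ n =
      1 / 2 ^ (n * (N - 1)) * ∑ α ∈ Fintype.piFinset fun _ : Fin n => A,
        Real.exp (-t * ∑ a, energy N q J (α a).card) * ∏ a, (sgn γ (α a) : ℝ) := by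
    intro γ hγ
    rw [eigval_card_eq_half hq J t hA hγ, mul_pow, div_pow, one_pow, ← pow_mul, mul_comm n]
    congr 1
    rw [← Fin.prod_const, Finset.prod_univ_sum]
    refine Finset.sum_congr rfl fun α _ => ?_
    rw [Finset.prod_mul_distrib, Finset.mul_sum, Real.exp_sum]
  rw [Finset.sum_congr rfl fun γ hγ => h γ (Finset.mem_filter.mp hγ).2, ← Finset.mul_sum,
    Finset.sum_comm]
  congr 1
  refine Finset.sum_congr rfl fun α _ => ?_
  rw [← Finset.mul_sum]
  push_cast
  rfl

variable {ι : Type*} [Fintype ι] [DecidableEq ι]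

/-- `X` is, up to a phase, a Majorana string, namely the one whose character `γ ↦ (-1)^{|γ ∩ δ|}`
is `k`. -/
def IsString (ψ : Fin N → Matrix ι ι ℂ) (X : Matrix ι ι ℂ) (k : Finset (Fin N) → ℤ) : Prop :=
  ∃ δ, PhaseEq X (majString ψ δ) ∧ ∀ γ, k γ = sgn γ δ

namespace IsMajorana

variable {ψ : Fin N → Matrix ι ι ℂ} (hψ : IsMajorana ψ)

lemma isString_majString (δ : Finset (Fin N)) : IsString ψ (majString ψ δ) fun γ => sgn γ δ :=
  ⟨δ, .refl _, fun _ => rfl⟩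

lemma isString_one : IsString ψ 1 fun _ => 1 :=
  ⟨∅, .of_eq (majString_empty ψ).symm, by simp⟩

include hψ

lemma isString_mul {X Y : Matrix ι ι ℂ} {k l : Finset (Fin N) → ℤ} (hX : IsString ψ X k)
    (hY : IsString ψ Y l) : IsString ψ (X * Y) fun γ => k γ * l γ := by
  obtain ⟨δ, hδ, hk⟩ := hX
  obtain ⟨ε, hε, hl⟩ := hY
  refine ⟨symmDiff δ ε, (hδ.mul hε).trans (hψ.majString_mul δ ε), fun γ => ?_⟩
  simp only [hk, hl]
  rw [sgn_comm γ (symmDiff δ ε), sgn_symmDiff, sgn_comm δ, sgn_comm ε]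

/-- The character of a product of strings is the product of the characters, so the symmetric
difference of the factors need not be computed. -/
lemma isString_prod {n : ℕ} (α : Fin n → Finset (Fin N)) :
    IsString ψ (List.ofFn fun a => majString ψ (α a)).prod fun γ => ∏ a, sgn γ (α a) := by
  induction n with
  | zero => simpa using isString_one
  | succ n ih =>
    simp only [List.ofFn_succ, List.prod_cons, Fin.prod_univ_succ]
    exact hψ.isString_mul (isString_majString _) (ih fun a => α a.succ)

lemma sq_norm_trace_isString_of_odd (hN : Odd N) {X : Matrix ι ι ℂ} {k : Finset (Fin N) → ℤ}
    (hX : IsString ψ X k) :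
    ‖X.trace‖ ^ 2 = ((∑ γ : Finset (Fin N) with Even γ.card, k γ : ℤ) : ℝ) := by
  obtain ⟨δ, hδ, hk⟩ := hX
  rw [hδ.norm_trace, hψ.sq_norm_trace_of_odd hN]
  simp only [hk]

lemma sq_norm_trace_isString_of_even (hN : Even N) {X : Matrix ι ι ℂ} {k : Finset (Fin N) → ℤ}
    (hX : IsString ψ X k) : ‖X.trace‖ ^ 2 = ((∑ γ, k γ : ℤ) : ℝ) := by
  obtain ⟨δ, hδ, hk⟩ := hX
  rw [hδ.norm_trace, hψ.sq_norm_trace_of_even hN]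
  simp only [hk]

omit hψ in
/-- Summed over the sign `f`, the cross terms between the two parts of `Π_f` cancel. -/
lemma sum_units_sq_norm (F : ℤˣ → ℂ) {a b : ℂ}
    (hF : ∀ f : ℤˣ, F f = (1 / 2 : ℂ) * (a + ((f : ℤ) : ℂ) * b)) :
    ∑ f, ‖F f‖ ^ 2 = (‖a‖ ^ 2 + ‖b‖ ^ 2) / 2 := by
  have h := parallelogram_law_with_norm ℝ a b
  rw [UnitsInt.univ, Finset.sum_pair (by decide), hF, hF, norm_mul, norm_mul]
  simp only [Units.val_one, Int.cast_one, one_mul, Units.val_neg, Int.cast_neg, neg_mul,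
    ← sub_eq_add_neg, mul_pow]
  norm_num
  linarith

/-- The sum over the parities of `|Tr (X Π_{f₁} ψ_{α₁} Π_{f₂} ψ_{α₂} ⋯)|²`. -/
def paritySum (ψ : Fin N → Matrix ι ι ℂ) {n : ℕ} (α : Fin n → Finset (Fin N))
    (X : Matrix ι ι ℂ) : ℝ :=
  ∑ f : Fin n → ℤˣ,
    ‖(X * (List.ofFn fun a => parityProj ψ (f a) * majString ψ (α a)).prod).trace‖ ^ 2

/-- The total parity `(-1)^F`. -/
def parity (ψ : Fin N → Matrix ι ι ℂ) : Matrix ι ι ℂ :=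
  (-Complex.I) ^ (N / 2) • majString ψ Finset.univ

omit hψ in
lemma isString_parity : IsString ψ (parity ψ) fun γ => sgn γ Finset.univ :=
  ⟨Finset.univ, .smul (by simp) _, fun _ => rfl⟩

omit hψ in
lemma paritySum_succ {n : ℕ} (α : Fin (n + 1) → Finset (Fin N)) (X : Matrix ι ι ℂ) :
    paritySum ψ α X =
      (paritySum ψ (fun a => α a.succ) (X * majString ψ (α 0)) +
        paritySum ψ (fun a => α a.succ) (X * parity ψ * majString ψ (α 0))) / 2 := by
  simp only [paritySum]
  rw [← (Fin.consEquiv fun _ => ℤˣ).sum_comp, Fintype.sum_prod_type, Finset.sum_comm,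
    ← Finset.sum_add_distrib, Finset.sum_div]
  refine Finset.sum_congr rfl fun f _ => sum_units_sq_norm _ fun e => ?_
  simp only [List.ofFn_succ, List.prod_cons, Fin.consEquiv_apply, Fin.cons_zero, Fin.cons_succ]
  rw [parityProj, mul_smul, ← parity, ← mul_assoc, ← mul_assoc, mul_smul_comm, mul_add, mul_one,
    mul_smul_comm, smul_mul_assoc, smul_mul_assoc, add_mul, add_mul, trace_smul, trace_add,
    smul_mul_assoc, smul_mul_assoc, trace_smul, smul_eq_mul, smul_eq_mul]

/-- Peeling off the projectors one at a time leaves an average over strings with or without a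
factor `(-1)^F`, which does not change the character at the even sets. -/
lemma paritySum_add (hN : Even N) {n : ℕ} (α : Fin n → Finset (Fin N)) {X Y : Matrix ι ι ℂ}
    {k l : Finset (Fin N) → ℤ} (hX : IsString ψ X k) (hY : IsString ψ Y l)
    (hkl : ∀ γ, l γ = k γ * sgn γ Finset.univ) :
    paritySum ψ α X + paritySum ψ α Y =
      2 * ((∑ γ : Finset (Fin N) with Even γ.card, k γ * ∏ a, sgn γ (α a) : ℤ) : ℝ) := by
  induction n generalizing X Y k l with
  | zero =>
    simp only [paritySum, List.ofFn_zero, List.prod_nil, mul_one, Finset.sum_const,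
      Finset.card_univ, Fintype.card_unique, one_smul, Finset.univ_eq_empty, Finset.prod_empty]
    rw [hψ.sq_norm_trace_isString_of_even hN hX, hψ.sq_norm_trace_isString_of_even hN hY,
      ← Int.cast_add, ← Finset.sum_add_distrib]
    have h := two_mul_sum_even k
    have h' := congrArg (Int.cast (R := ℝ)) h
    rw [Int.cast_mul] at h'
    refine Eq.trans ?_ h'.symm
    congr 1
    refine Finset.sum_congr rfl fun γ _ => ?_
    rw [hkl, sgn_comm γ]; ring
  | succ n ih =>
    have hα := isString_majString (ψ := ψ) (α 0)
    have hP := isString_parity (ψ := ψ)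
    rw [paritySum_succ, paritySum_succ, ← add_div,
      ih (fun a => α a.succ) (hψ.isString_mul hX hα)
        (hψ.isString_mul (hψ.isString_mul hX hP) hα) (fun γ => by ring),
      ih (fun a => α a.succ) (hψ.isString_mul hY hα)
        (hψ.isString_mul (hψ.isString_mul hY hP) hα) (fun γ => by ring)]
    have h : ∀ γ ∈ Finset.univ.filter (fun γ : Finset (Fin N) => Even γ.card),
        l γ * sgn γ (α 0) * ∏ a : Fin n, sgn γ (α a.succ) =
          k γ * sgn γ (α 0) * ∏ a : Fin n, sgn γ (α a.succ) := by
      intro γ hγ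
      rw [hkl, sgn_comm γ Finset.univ, sgn_univ_left, (Finset.mem_filter.mp hγ).2.neg_one_pow,
        mul_one]
    rw [Finset.sum_congr rfl h]
    simp only [Fin.prod_univ_succ, mul_assoc]
    ring

lemma paritySum_one (hN : Even N) {n : ℕ} (hn : 1 ≤ n) (α : Fin n → Finset (Fin N)) :
    paritySum ψ α 1 =
      ((∑ γ : Finset (Fin N) with Even γ.card, ∏ a, sgn γ (α a) : ℤ) : ℝ) := by
  obtain ⟨m, rfl⟩ := Nat.exists_eq_add_of_le' hn
  have hα := isString_majString (ψ := ψ) (α 0)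
  have hP := isString_parity (ψ := ψ)
  rw [paritySum_succ, one_mul, one_mul,
    hψ.paritySum_add hN (fun a => α a.succ) hα (hψ.isString_mul hP hα) (fun γ => by ring)]
  simp only [Fin.prod_univ_succ]
  ring

lemma stringMomentEven_eq (hN : Even N) {A : Finset (Finset (Fin N))} (hA : IsHalf A) {q : ℕ}
    (hq : Even q) {n : ℕ} (hn : 1 ≤ n) (J t : ℝ) :
    (stringMomentEven ψ A q n J t : ℂ) = (rho ψ q J t ^ n).trace := by
  rw [hψ.trace_rho_pow q J t hn, sum_eigval_pow hq J t hA, stringMomentEven]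
  congr 2
  refine Finset.sum_congr rfl fun α _ => ?_
  rw [← hψ.paritySum_one hN hn, paritySum]
  simp only [one_mul]

lemma stringMomentOdd_eq (hN : Odd N) {A : Finset (Finset (Fin N))} (hA : IsHalf A) {q : ℕ}
    (hq : Even q) {n : ℕ} (hn : 1 ≤ n) (J t : ℝ) :
    (stringMomentOdd ψ A q n J t : ℂ) = (rho ψ q J t ^ n).trace := by
  rw [hψ.trace_rho_pow q J t hn, sum_eigval_pow hq J t hA, stringMomentOdd]
  congr 2
  refine Finset.sum_congr rfl fun α _ => ?_
  rw [hψ.sq_norm_trace_isString_of_odd hN (hψ.isString_prod α)]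

end IsMajorana

end

section
/-! ### Powers of averaged exponentials in a Banach algebra -/

section Banach

open Filter Topology MeasureTheory ProbabilityTheory

variable {𝔸 : Type*} [NormedRing 𝔸] [NormedAlgebra ℂ 𝔸] [CompleteSpace 𝔸]

lemma norm_exp_sub_sum_le [NormOneClass 𝔸] (a : 𝔸) (k : ℕ) :
    ‖NormedSpace.exp a - ∑ i ∈ Finset.range k, ((i.factorial : ℂ)⁻¹) • a ^ i‖ ≤
      ‖a‖ ^ k * Real.exp ‖a‖ := by
  have h1 := (hasSum_nat_add_iff' k).mpr (NormedSpace.exp_series_hasSum_exp' (𝕂 := ℂ) a)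
  have h2 : HasSum (fun n : ℕ => ‖a‖ ^ k * (‖a‖ ^ n / n.factorial)) (‖a‖ ^ k * Real.exp ‖a‖) := by
    rw [Real.exp_eq_exp_ℝ]
    exact (NormedSpace.expSeries_div_hasSum_exp ‖a‖).mul_left _
  refine h1.norm_le_of_bounded h2 fun n => ?_
  rw [norm_smul, norm_inv, Complex.norm_natCast]
  calc ((n + k).factorial : ℝ)⁻¹ * ‖a ^ (n + k)‖
      ≤ (n.factorial : ℝ)⁻¹ * ‖a‖ ^ (n + k) := by
        gcongr
        · omega
        · exact norm_pow_le a _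
    _ = _ := by rw [pow_add]; ring

lemma norm_exp_le [NormOneClass 𝔸] (a : 𝔸) : ‖NormedSpace.exp a‖ ≤ Real.exp ‖a‖ := by
  simpa using norm_exp_sub_sum_le a 0

omit [NormedAlgebra ℂ 𝔸] [CompleteSpace 𝔸] in
lemma norm_pow_sub_pow_le [NormOneClass 𝔸] {x y : 𝔸} {r : ℝ} (hr : 1 ≤ r) (hx : ‖x‖ ≤ r)
    (hy : ‖y‖ ≤ r) (n : ℕ) :
    ‖x ^ n - y ^ n‖ ≤ n * r ^ n * ‖x - y‖ := by
  induction n with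
  | zero => simp
  | succ n ih =>
    have h : x ^ (n + 1) - y ^ (n + 1) = x ^ n * (x - y) + (x ^ n - y ^ n) * y := by
      rw [pow_succ, pow_succ]; noncomm_ring
    have hr0 : 0 ≤ r := zero_le_one.trans hr
    rw [h]
    calc _ ≤ ‖x ^ n‖ * ‖x - y‖ + ‖x ^ n - y ^ n‖ * ‖y‖ :=
          (norm_add_le _ _).trans (add_le_add (norm_mul_le _ _) (norm_mul_le _ _))
      _ ≤ r ^ n * r * ‖x - y‖ + n * r ^ n * ‖x - y‖ * r := by
          gcongr
          calc ‖x ^ n‖ ≤ ‖x‖ ^ n := norm_pow_le x n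
            _ ≤ r ^ n := by gcongr
            _ ≤ r ^ n * r := le_mul_of_one_le_right (by positivity) hr
      _ = _ := by push_cast; ring

/-- The Euler product formula in a Banach algebra: if `Φ_M = 1 + B / M + o(1 / M)` then
`Φ_M ^ M` converges to `e^B`. It is compared with `(e^{B / M})^M`. -/
lemma tendsto_pow_exp [NormOneClass 𝔸] {Φ : ℕ → 𝔸} {B : 𝔸}
    (h : Tendsto (fun M : ℕ => (M : ℂ) • (Φ M - 1)) atTop (𝓝 B)) :
    Tendsto (fun M => Φ M ^ M) atTop (𝓝 (NormedSpace.exp B)) := by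
  set E : ℕ → 𝔸 := fun M => NormedSpace.exp ((M : ℂ)⁻¹ • B) with hE
  have hEpow : ∀ M : ℕ, M ≠ 0 → E M ^ M = NormedSpace.exp B := by
    intro M hM
    let _ : NormedAlgebra ℚ 𝔸 := NormedAlgebra.restrictScalars ℚ ℂ 𝔸
    rw [hE, ← NormedSpace.exp_nsmul, ← Nat.cast_smul_eq_nsmul ℂ, smul_smul, mul_inv_cancel₀,
      one_smul]
    exact_mod_cast hM
  have hElim : Tendsto (fun M : ℕ => (M : ℂ) • (E M - 1)) atTop (𝓝 B) := by
    have h1 := (hasFDerivAt_exp_zero (𝕂 := ℂ) (𝔸 := 𝔸)).lim B (c := fun M : ℕ => (M : ℂ))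
      (l := atTop) (by simpa using tendsto_natCast_atTop_atTop)
    simpa [hE] using h1
  have hdiff : Tendsto (fun M : ℕ => (M : ℝ) * ‖Φ M - E M‖) atTop (𝓝 0) := by
    have h1 := (h.sub hElim).norm
    rw [sub_self, norm_zero] at h1
    refine h1.congr fun M => ?_
    rw [← smul_sub, norm_smul, Complex.norm_natCast, sub_sub_sub_cancel_right]
  rw [tendsto_iff_norm_sub_tendsto_zero]
  -- Eventually both `Φ_M` and `e^{B / M}` have norm at most `e^{C / M}`, whose `M`-th power is
  -- `e^C`.
  set C := ‖B‖ + 1 with hC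
  have hlim : Tendsto (fun M : ℕ => Real.exp C * ((M : ℝ) * ‖Φ M - E M‖)) atTop (𝓝 0) := by
    simpa using hdiff.const_mul (Real.exp C)
  refine squeeze_zero' (Eventually.of_forall fun _ => norm_nonneg _) ?_ hlim
  filter_upwards [h.norm.eventually (gt_mem_nhds (show ‖B‖ < C by linarith)),
    eventually_gt_atTop 0] with M hM hM0
  have hMr : (0 : ℝ) < M := by exact_mod_cast hM0
  rw [norm_smul, Complex.norm_natCast] at hM
  have hΦ : ‖Φ M‖ ≤ Real.exp (C / M) := by
    calc ‖Φ M‖ = ‖(Φ M - 1) + 1‖ := by rw [sub_add_cancel]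
      _ ≤ ‖Φ M - 1‖ + 1 := (norm_add_le _ _).trans (by rw [norm_one])
      _ ≤ C / M + 1 := by gcongr; rw [le_div_iff₀ hMr]; linarith
      _ ≤ _ := Real.add_one_le_exp _
  have hE' : ‖E M‖ ≤ Real.exp (C / M) := by
    refine (norm_exp_le _).trans (Real.exp_le_exp.mpr ?_)
    rw [norm_smul, norm_inv, Complex.norm_natCast, inv_mul_eq_div]
    gcongr; linarith
  have h1 := norm_pow_sub_pow_le (Real.one_le_exp (by positivity)) hΦ hE' M
  rw [hEpow M hM0.ne', ← Real.exp_nat_mul, mul_div_cancel₀ _ hMr.ne'] at h1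
  linarith

/-- The ordered product of independent factors averages to the power of the average. -/
lemma integral_list_prod {X : Type*} [MeasurableSpace X] (ν : Measure X) [IsProbabilityMeasure ν]
    {F : X → 𝔸} (hF : Integrable F ν) (M : ℕ) :
    Integrable (fun x : Fin M → X => (List.ofFn fun m : Fin M => F (x m.rev)).prod)
        (Measure.pi fun _ => ν) ∧
      ∫ x : Fin M → X, (List.ofFn fun m : Fin M => F (x m.rev)).prod ∂(Measure.pi fun _ => ν) =
        (∫ x, F x ∂ν) ^ M := by
  induction M with
  | zero => simp
  | succ M ih =>
    have hmp := measurePreserving_piFinSuccAbove (fun _ : Fin (M + 1) => ν) (Fin.last M)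
    set G : X × (Fin M → X) → 𝔸 := fun z =>
      F z.1 * (List.ofFn fun m : Fin M => F (z.2 m.rev)).prod with hG
    have hGint : Integrable G (ν.prod (Measure.pi fun _ => ν)) := hF.mul_prod ih.1
    have hcomp : (fun x : Fin (M + 1) → X => (List.ofFn fun m => F (x m.rev)).prod) =
        G ∘ MeasurableEquiv.piFinSuccAbove (fun _ => X) (Fin.last M) := by
      ext x
      simp only [List.ofFn_succ, List.prod_cons, Fin.rev_zero, Fin.rev_succ, hG,
        Function.comp_apply]
      simp [MeasurableEquiv.piFinSuccAbove, Fin.init]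
    rw [hcomp]
    refine ⟨hmp.integrable_comp_of_integrable hGint, ?_⟩
    rw [show (∫ x, (G ∘ MeasurableEquiv.piFinSuccAbove (fun _ => X) (Fin.last M)) x
      ∂(Measure.pi fun _ => ν)) = _ from hmp.integral_comp' G, pow_succ']
    rw [← ih.2]
    exact integral_prod_bilin (ContinuousLinearMap.mul ℂ 𝔸) hF ih.1

/-! ### Gaussian averages -/

variable {K : Type*} [Fintype K]

/-- The standard Gaussian law on `K → ℝ`. -/
abbrev stdGaussian (K : Type*) [Fintype K] : Measure (K → ℝ) :=
  Measure.pi fun _ => gaussianReal 0 1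

lemma integral_mul_stdGaussian [DecidableEq K] (k l : K) :
    ∫ y : K → ℝ, y k * y l ∂(stdGaussian K) = if k = l then 1 else 0 := by
  have h := integral_fintype_prod_eq_prod (𝕜 := ℝ) (μ := fun _ : K => gaussianReal 0 1)
    -- a product over all coordinates which equals `y k * y l`, also for `k = l`
    (fun (i : K) (x : ℝ) => (if i = k then x else 1) * (if i = l then x else 1))
  have h1 : ∀ y : K → ℝ, ∏ i, (if i = k then y i else 1) * (if i = l then y i else 1) =
      y k * y l := by
    intro y
    rw [Finset.prod_mul_distrib]
    simp
  simp only [h1] at h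
  rw [h]
  have hsq : ∫ x : ℝ, x * x ∂(gaussianReal 0 1) = 1 := by
    have := variance_id_gaussianReal (μ := 0) (v := 1)
    rw [variance_eq_integral measurable_id.aemeasurable] at this
    simpa [sq] using this
  split_ifs with hkl
  · subst hkl
    refine Finset.prod_eq_one fun i _ => ?_
    by_cases hi : i = k
    · simpa [hi] using hsq
    · simp [hi]
  · refine Finset.prod_eq_zero (Finset.mem_univ k) ?_
    simp [hkl, integral_id_gaussianReal]

/-- The linear combination `∑_k x_k a_k` with real coefficients. -/
def linComb (a : K → 𝔸) (x : K → ℝ) : 𝔸 := ∑ k, (x k : ℂ) • a k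

omit [CompleteSpace 𝔸] in
lemma continuous_linComb (a : K → 𝔸) : Continuous (linComb a) := by
  unfold linComb
  fun_prop

lemma continuous_exp_linComb (a : K → 𝔸) :
    Continuous fun x => NormedSpace.exp (linComb a x) := by
  let _ : NormedAlgebra ℚ 𝔸 := NormedAlgebra.restrictScalars ℚ ℂ 𝔸
  exact NormedSpace.exp_continuous.comp (continuous_linComb a)

omit [CompleteSpace 𝔸] in
lemma linComb_smul (a : K → 𝔸) (h : ℝ) (x : K → ℝ) :
    linComb a (fun k => h * x k) = (h : ℂ) • linComb a x := by
  simp only [linComb, Finset.smul_sum, smul_smul, Complex.ofReal_mul]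

omit [CompleteSpace 𝔸] in
lemma integrable_exp_norm_linComb (a : K → 𝔸) {c : ℝ} (hc : 0 ≤ c) :
    Integrable (fun y => Real.exp (c * ‖linComb a y‖)) (stdGaussian K) := by
  have h1 : Integrable (fun y : K → ℝ => ∏ k, Real.exp ((c * ‖a k‖) * |y k|)) (stdGaussian K) :=
    Integrable.fintype_prod_dep (f := fun k x => Real.exp ((c * ‖a k‖) * |x|)) fun k =>
      integrable_exp_mul_abs (X := id) (integrable_exp_mul_gaussianReal _)
        (integrable_exp_mul_gaussianReal _)
  refine h1.mono' (Real.continuous_exp.comp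
    (continuous_const.mul (continuous_linComb a).norm)).aestronglyMeasurable
    (Eventually.of_forall fun y => ?_)
  rw [Real.norm_eq_abs, Real.abs_exp, ← Real.exp_sum, Real.exp_le_exp]
  simp only [mul_assoc, ← Finset.mul_sum]
  gcongr
  refine (norm_sum_le _ _).trans (Finset.sum_le_sum fun k _ => ?_)
  rw [norm_smul, Complex.norm_real, Real.norm_eq_abs, mul_comm]

omit [CompleteSpace 𝔸] in
lemma integrable_of_norm_le_exp (a : K → 𝔸) {c : ℝ} (hc : 0 ≤ c) {f : (K → ℝ) → 𝔸}
    (hf : Continuous f) (h : ∀ y, ‖f y‖ ≤ Real.exp (c * ‖linComb a y‖)) :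
    Integrable f (stdGaussian K) :=
  (integrable_exp_norm_linComb a hc).mono' hf.aestronglyMeasurable (Eventually.of_forall h)

lemma integrable_exp_linComb [NormOneClass 𝔸] (a : K → 𝔸) :
    Integrable (fun y => NormedSpace.exp (linComb a y)) (stdGaussian K) :=
  integrable_of_norm_le_exp a zero_le_one (continuous_exp_linComb a) fun y => by
    simpa using norm_exp_le (linComb a y)

lemma integrable_apply_stdGaussian (k : K) :
    Integrable (fun y : K → ℝ => y k) (stdGaussian K) :=
  integrable_comp_eval (f := fun x => x) (μ := fun _ : K => gaussianReal 0 1)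
    ((memLp_id_gaussianReal (μ := 0) (v := 1) 1).integrable le_rfl)

lemma integrable_mul_stdGaussian (k l : K) :
    Integrable (fun y : K → ℝ => y k * y l) (stdGaussian K) := by
  have h : ∀ k : K, MemLp (fun y : K → ℝ => y k) 2 (stdGaussian K) := fun k =>
    (memLp_id_gaussianReal (μ := 0) (v := 1) 2).comp_measurePreserving
      (measurePreserving_eval (fun _ : K => gaussianReal 0 1) k)
  exact (h k).integrable_mul (h l)

omit [CompleteSpace 𝔸] in
lemma integrable_linComb (a : K → 𝔸) : Integrable (linComb a) (stdGaussian K) :=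
  integrable_finsetSum _ fun k _ => (integrable_apply_stdGaussian k).ofReal.smul_const _

omit [CompleteSpace 𝔸] in
lemma linComb_mul_self (a : K → 𝔸) (y : K → ℝ) :
    linComb a y * linComb a y = ∑ k, ∑ l, ((y k * y l : ℝ) : ℂ) • (a k * a l) := by
  simp only [linComb, Finset.sum_mul_sum, smul_mul_smul_comm, Complex.ofReal_mul]

omit [CompleteSpace 𝔸] in
lemma integrable_linComb_sq (a : K → 𝔸) :
    Integrable (fun y => linComb a y * linComb a y) (stdGaussian K) := by
  simp only [linComb_mul_self]
  exact integrable_finsetSum _ fun k _ => integrable_finsetSum _ fun l _ =>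
    (integrable_mul_stdGaussian k l).ofReal.smul_const _

lemma integral_linComb (a : K → 𝔸) : ∫ y, linComb a y ∂(stdGaussian K) = 0 := by
  unfold linComb
  have hint : ∀ k, Integrable (fun y : K → ℝ => (y k : ℂ) • a k) (stdGaussian K) :=
    fun k => (integrable_apply_stdGaussian k).ofReal.smul_const _
  rw [integral_finsetSum _ fun k _ => hint k]
  refine Finset.sum_eq_zero fun k _ => ?_
  rw [integral_smul_const, integral_complex_ofReal]
  have : ∫ y : K → ℝ, y k ∂(stdGaussian K) = 0 := by
    have h := integral_comp_eval (μ := fun _ : K => gaussianReal 0 1) (i := k) (f := fun x : ℝ => x)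
      continuous_id.aestronglyMeasurable
    rw [h]
    exact integral_id_gaussianReal
  rw [this]; simp

lemma integral_linComb_sq (a : K → 𝔸) :
    ∫ y, linComb a y * linComb a y ∂(stdGaussian K) = ∑ k, a k * a k := by
  classical
  simp only [linComb_mul_self]
  have hint : ∀ k l, Integrable (fun y : K → ℝ => ((y k * y l : ℝ) : ℂ) • (a k * a l))
      (stdGaussian K) := fun k l => (integrable_mul_stdGaussian k l).ofReal.smul_const _
  rw [integral_finsetSum _ fun k _ => integrable_finsetSum _ fun l _ => hint k l]
  refine Finset.sum_congr rfl fun k _ => ?_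
  rw [integral_finsetSum _ fun l _ => hint k l]
  simp only [integral_smul_const, integral_complex_ofReal, integral_mul_stdGaussian]
  simp

/-- The second-order expansion of the average of `e^{h ∑ y_k a_k}` in the standard deviation `h`. -/
lemma norm_integral_exp_sub_le [NormOneClass 𝔸] (a : K → 𝔸) {h : ℝ} (h0 : 0 ≤ h) (h1 : h ≤ 1) :
    ‖∫ y, NormedSpace.exp ((h : ℂ) • linComb a y) ∂(stdGaussian K) -
        (1 + ((h ^ 2 / 2 : ℝ) : ℂ) • ∑ k, a k * a k)‖ ≤
      h ^ 3 * ∫ y, Real.exp (4 * ‖linComb a y‖) ∂(stdGaussian K) := by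
  have hexp : Integrable (fun y => NormedSpace.exp ((h : ℂ) • linComb a y)) (stdGaussian K) := by
    simp only [← linComb_smul]
    refine integrable_of_norm_le_exp a zero_le_one ((continuous_exp_linComb a).comp
      (by fun_prop : Continuous fun y : K → ℝ => fun k => h * y k)) fun y => ?_
    rw [linComb_smul, one_mul]
    refine (norm_exp_le _).trans (Real.exp_le_exp.mpr ?_)
    rw [norm_smul, Complex.norm_real, Real.norm_of_nonneg h0]
    exact mul_le_of_le_one_left (norm_nonneg _) h1
  have hlin : Integrable (fun y => (h : ℂ) • linComb a y) (stdGaussian K) :=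
    (integrable_linComb a).smul (h : ℂ)
  have hsq : Integrable (fun y => ((h ^ 2 / 2 : ℝ) : ℂ) • (linComb a y * linComb a y))
      (stdGaussian K) := (integrable_linComb_sq a).smul ((h ^ 2 / 2 : ℝ) : ℂ)
  have hone : Integrable (fun _ : K → ℝ => (1 : 𝔸)) (stdGaussian K) := integrable_const _
  have hadd : Integrable (fun y => 1 + (h : ℂ) • linComb a y) (stdGaussian K) := hone.add hlin
  have hadd' : Integrable (fun y => 1 + (h : ℂ) • linComb a y +
      ((h ^ 2 / 2 : ℝ) : ℂ) • (linComb a y * linComb a y)) (stdGaussian K) := hadd.add hsq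
  have heq : ∫ y, NormedSpace.exp ((h : ℂ) • linComb a y) ∂(stdGaussian K) -
        (1 + ((h ^ 2 / 2 : ℝ) : ℂ) • ∑ k, a k * a k) =
      ∫ y, (NormedSpace.exp ((h : ℂ) • linComb a y) - (1 + (h : ℂ) • linComb a y +
        ((h ^ 2 / 2 : ℝ) : ℂ) • (linComb a y * linComb a y))) ∂(stdGaussian K) := by
    rw [integral_sub hexp hadd', integral_add hadd hsq,
      integral_add hone hlin, integral_smul, integral_smul, integral_linComb, integral_linComb_sq]
    simp
  rw [heq, ← integral_const_mul]
  refine norm_integral_le_of_norm_le ((integrable_exp_norm_linComb a (by norm_num)).const_mul _)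
    (Eventually.of_forall fun y => ?_)
  have h3 := norm_exp_sub_sum_le ((h : ℂ) • linComb a y) 3
  have h4 : ∑ i ∈ Finset.range 3, ((i.factorial : ℂ)⁻¹) • ((h : ℂ) • linComb a y) ^ i =
      1 + (h : ℂ) • linComb a y + ((h ^ 2 / 2 : ℝ) : ℂ) • (linComb a y * linComb a y) := by
    simp only [Finset.sum_range_succ, Finset.sum_range_zero, sq, smul_mul_smul_comm, smul_smul]
    simp [Nat.factorial]
    congr 1
    ring
  rw [h4] at h3
  refine h3.trans ?_
  rw [norm_smul, Complex.norm_real, Real.norm_of_nonneg h0, mul_pow, mul_assoc]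
  gcongr
  -- The cubic remainder is absorbed into an integrable exponential, uniformly in `h ≤ 1`.
  set r := ‖linComb a y‖
  have hr : 0 ≤ r := norm_nonneg _
  calc r ^ 3 * Real.exp (h * r) ≤ Real.exp r ^ 3 * Real.exp r := by
        gcongr
        · linarith [Real.add_one_le_exp r]
        · exact mul_le_of_le_one_left hr h1
    _ = Real.exp (4 * r) := by rw [← pow_succ, ← Real.exp_nat_mul]; norm_num

/-- The law with variance `v` as a rescaling of the standard one; `v = 0` is allowed. -/
lemma measurePreserving_scale_stdGaussian {v : ℝ} (hv : 0 ≤ v) :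
    MeasurePreserving (fun (y : K → ℝ) k => Real.sqrt v * y k) (stdGaussian K)
      (Measure.pi fun _ => gaussianReal 0 (Real.toNNReal v)) := by
  refine measurePreserving_pi _ _ fun _ => ⟨by fun_prop, ?_⟩
  rw [gaussianReal_map_const_mul, mul_zero, mul_one]
  congr 1
  ext
  simp [Real.sq_sqrt hv, Real.coe_toNNReal v hv]

lemma integrable_exp_linComb_gaussian [NormOneClass 𝔸] (a : K → 𝔸) {v : ℝ} (hv : 0 ≤ v) :
    Integrable (fun x => NormedSpace.exp (linComb a x))
      (Measure.pi fun _ : K => gaussianReal 0 (Real.toNNReal v)) := by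
  have hmp := measurePreserving_scale_stdGaussian (K := K) hv
  rw [← hmp.integrable_comp (continuous_exp_linComb a).aestronglyMeasurable]
  have h := integrable_exp_linComb (K := K) fun k => ((Real.sqrt v : ℝ) : ℂ) • a k
  refine h.congr (Eventually.of_forall fun y => ?_)
  simp only [Function.comp_apply, linComb, smul_smul, Complex.ofReal_mul, mul_comm]

/-- The average of the exponential of a Gaussian combination `∑_k x_k a_k` of variance `T / M`,
raised to the power `M`, tends to the exponential of the generator `(T / 2) ∑_k a_k²`. -/
lemma tendsto_integral_exp_pow [NormOneClass 𝔸] (a : K → 𝔸) {T : ℝ} (hT : 0 ≤ T) :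
    Tendsto (fun M : ℕ => (∫ x, NormedSpace.exp (linComb a x)
        ∂(Measure.pi fun _ : K => gaussianReal 0 (Real.toNNReal (T / M)))) ^ M) atTop
      (𝓝 (NormedSpace.exp (((T / 2 : ℝ) : ℂ) • ∑ k, a k * a k))) := by
  refine tendsto_pow_exp ?_
  rw [tendsto_iff_norm_sub_tendsto_zero]
  set C := ∫ y, Real.exp (4 * ‖linComb a y‖) ∂(stdGaussian K)
  have hdiv : Tendsto (fun M : ℕ => T / (M : ℝ)) atTop (𝓝 0) :=
    tendsto_const_div_atTop_nhds_zero_nat T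
  have hlim : Tendsto (fun M : ℕ => T * Real.sqrt (T / M) * C) atTop (𝓝 0) := by
    have := ((Real.continuous_sqrt.tendsto _).comp hdiv).const_mul T |>.mul_const C
    simpa using this
  refine squeeze_zero' (Eventually.of_forall fun _ => norm_nonneg _) ?_ hlim
  filter_upwards [hdiv.eventually (gt_mem_nhds zero_lt_one), eventually_gt_atTop 0] with M hM hM0
  have hMr : (0 : ℝ) < M := by exact_mod_cast hM0
  have hv : 0 ≤ T / M := by positivity
  have hs : Real.sqrt (T / M) ≤ 1 := by
    rw [Real.sqrt_le_left zero_le_one]; simpa using hM.le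
  have h := norm_integral_exp_sub_le a (Real.sqrt_nonneg (T / M)) hs
  have hmp := measurePreserving_scale_stdGaussian (K := K) hv
  have hint : ∫ x, NormedSpace.exp (linComb a x)
      ∂(Measure.pi fun _ : K => gaussianReal 0 (Real.toNNReal (T / M))) =
      ∫ y, NormedSpace.exp (((Real.sqrt (T / M) : ℝ) : ℂ) • linComb a y) ∂(stdGaussian K) := by
    rw [← hmp.map_eq, integral_map hmp.measurable.aemeasurable
      (continuous_exp_linComb a).aestronglyMeasurable]
    simp only [linComb_smul]
  rw [hint]
  set I := ∫ y, NormedSpace.exp (((Real.sqrt (T / M) : ℝ) : ℂ) • linComb a y) ∂(stdGaussian K)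
  -- `M h² = T` reproduces the generator, and the remainder is of order `M h³ = T h`.
  have heq : (M : ℂ) • (I - 1) - ((T / 2 : ℝ) : ℂ) • ∑ k, a k * a k =
      (M : ℂ) • (I - (1 + ((Real.sqrt (T / M) ^ 2 / 2 : ℝ) : ℂ) • ∑ k, a k * a k)) := by
    rw [Real.sq_sqrt hv, smul_sub, smul_sub, smul_add, smul_smul, ← sub_sub]
    congr 2
    push_cast
    have : (M : ℂ) ≠ 0 := by exact_mod_cast hM0.ne'
    field_simp
  rw [heq, norm_smul, Complex.norm_natCast]
  calc (M : ℝ) * _ ≤ M * (Real.sqrt (T / M) ^ 3 * C) := by gcongr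
    _ = (M * Real.sqrt (T / M) ^ 2) * Real.sqrt (T / M) * C := by ring
    _ = _ := by rw [Real.sq_sqrt hv, mul_div_cancel₀ _ hMr.ne']

end Banach

end

/-! ### The Brownian circuit -/

section Circuit

open Filter Topology MeasureTheory ProbabilityTheory

variable {ι : Type*} [Fintype ι] [DecidableEq ι] {N : ℕ}

/-- The inclusion `X ↦ X ⊗ 1`. -/
def leftHom : Matrix ι ι ℂ →+* Matrix (ι × ι) (ι × ι) ℂ where
  toFun X := X ⊗ₖ 1
  map_one' := one_kronecker_one
  map_zero' := zero_kronecker _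
  map_add' X Y := add_kronecker _ _ _
  map_mul' X Y := by rw [← mul_kronecker_mul, one_mul]

/-- The antilinear inclusion `X ↦ 1 ⊗ X*`. -/
def rightHom : Matrix ι ι ℂ →+* Matrix (ι × ι) (ι × ι) ℂ where
  toFun X := 1 ⊗ₖ X.map star
  map_one' := by rw [Matrix.map_one _ (star_zero _) (star_one _), one_kronecker_one]
  map_zero' := by ext; simp
  map_add' X Y := by ext; simp [mul_add]
  map_mul' X Y := by
    rw [← mul_kronecker_mul, one_mul]
    congr 1
    exact Matrix.map_mul (f := starRingEnd ℂ)

lemma doubled_eq_mul (X : Matrix ι ι ℂ) : doubled X = leftHom X * rightHom X := by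
  change X ⊗ₖ X.map star = (X ⊗ₖ 1) * (1 ⊗ₖ X.map star)
  rw [← mul_kronecker_mul, one_mul, mul_one]

lemma commute_leftHom_rightHom (X Y : Matrix ι ι ℂ) : Commute (leftHom X) (rightHom Y) := by
  change (X ⊗ₖ 1) * (1 ⊗ₖ Y.map star) = (1 ⊗ₖ Y.map star) * (X ⊗ₖ 1)
  rw [← mul_kronecker_mul, ← mul_kronecker_mul, one_mul, mul_one, one_mul, mul_one]

lemma continuous_leftHom : Continuous (leftHom (ι := ι)) := by
  refine continuous_matrix fun p p' => ?_
  change Continuous fun X : Matrix ι ι ℂ => X p.1 p'.1 * (1 : Matrix ι ι ℂ) p.2 p'.2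
  fun_prop

lemma continuous_rightHom : Continuous (rightHom (ι := ι)) := by
  refine continuous_matrix fun p p' => ?_
  change Continuous fun X : Matrix ι ι ℂ => (1 : Matrix ι ι ℂ) p.1 p'.1 * star (X p.2 p'.2)
  fun_prop

lemma leftHom_smul (c : ℂ) (X : Matrix ι ι ℂ) : leftHom (c • X) = c • leftHom X :=
  smul_kronecker _ _ _

lemma rightHom_smul (c : ℂ) (X : Matrix ι ι ℂ) : rightHom (c • X) = star c • rightHom X := by
  ext p p'
  simp [rightHom]
  ring

/-- Matrices as operators on a Euclidean space. These form a Banach algebra, while the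
exponential of matrices refers to the entrywise topology and no norm. -/
abbrev toOp : Matrix ι ι ℂ ≃⋆ₐ[ℂ] (EuclideanSpace ℂ ι →L[ℂ] EuclideanSpace ℂ ι) :=
  Matrix.toEuclideanCLM

lemma continuous_toOp_symm : Continuous (toOp (ι := ι)).symm :=
  LinearMap.continuous_of_finiteDimensional
    ((toOp (ι := ι)).symm.toAlgEquiv.toLinearMap)

lemma toOp_symm_exp (x : EuclideanSpace ℂ ι →L[ℂ] EuclideanSpace ℂ ι) :
    toOp.symm (NormedSpace.exp x) = NormedSpace.exp (toOp.symm x) :=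
  map_exp_of_continuous (RingHomClass.toRingHom (toOp (ι := ι)).symm) continuous_toOp_symm x

lemma map_exp_matrix {κ : Type*} [Fintype κ] [DecidableEq κ]
    (f : Matrix ι ι ℂ →+* Matrix κ κ ℂ) (hf : Continuous f) (X : Matrix ι ι ℂ) :
    f (NormedSpace.exp X) = NormedSpace.exp (f X) := by
  have h := map_exp_of_continuous (f.comp (RingHomClass.toRingHom (toOp (ι := ι)).symm))
    (hf.comp continuous_toOp_symm) (toOp X)
  change f (toOp.symm (NormedSpace.exp (toOp X))) = NormedSpace.exp (f (toOp.symm (toOp X))) at h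
  rwa [toOp_symm_exp, StarAlgEquiv.symm_apply_apply] at h

/-- As `U ⊗ U* = (U ⊗ 1) (1 ⊗ U*)` with commuting factors, the doubled exponential is an
exponential. -/
lemma doubled_exp (X : Matrix ι ι ℂ) :
    doubled (NormedSpace.exp X) = NormedSpace.exp (leftHom X + rightHom X) := by
  rw [Matrix.exp_add_of_commute _ _ (commute_leftHom_rightHom X X), doubled_eq_mul,
    map_exp_matrix leftHom continuous_leftHom, map_exp_matrix rightHom continuous_rightHom]

/-- The generator `-i (𝒪_α ⊗ 1 - 1 ⊗ 𝒪_α*)` of the doubled gate. -/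
def doubledDrive (ψ : Fin N → Matrix ι ι ℂ) (q : ℕ) (α : Strings N q) :
    Matrix (ι × ι) (ι × ι) ℂ :=
  -Complex.I • (leftHom (driveOp ψ q α) - rightHom (driveOp ψ q α))

lemma toOp_doubled_gate (ψ : Fin N → Matrix ι ι ℂ) (q : ℕ) (x : Strings N q → ℝ) :
    toOp (doubled (gate ψ q x)) =
      NormedSpace.exp (linComb (fun α => toOp (doubledDrive ψ q α)) x) := by
  refine (EquivLike.injective (toOp (ι := ι × ι)).symm) ?_
  rw [StarAlgEquiv.symm_apply_apply, toOp_symm_exp, gate, doubled_exp]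
  congr 1
  simp only [linComb, map_sum, map_smul, StarAlgEquiv.symm_apply_apply, leftHom_smul,
    rightHom_smul, doubledDrive, Finset.smul_sum, ← Finset.sum_add_distrib]
  refine Finset.sum_congr rfl fun α _ => ?_
  simp only [RCLike.star_def, map_neg, Complex.conj_I, Complex.conj_ofReal]
  module

/-- Since `𝒪_α² = 1`, the square of `-i (𝒪_α ⊗ 1 - 1 ⊗ 𝒪_α*)` is `-2 (1 - 𝒪_α ⊗ 𝒪_α*)`, and the
phase of `𝒪_α` drops out. -/
lemma IsMajorana.doubledDrive_mul_self {ψ : Fin N → Matrix ι ι ℂ} (hψ : IsMajorana ψ) {q : ℕ}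
    (hq : Even q) (α : Strings N q) :
    doubledDrive ψ q α * doubledDrive ψ q α =
      (-2 : ℂ) • (1 - doubled (majString ψ α.1)) := by
  have hsq : driveOp ψ q α * driveOp ψ q α = 1 := by
    rw [driveOp, smul_mul_smul_comm, hψ.majString_mul_self hq α.2, smul_smul, ← mul_pow, ← mul_pow]
    simp
  have hd : doubled (majString ψ α.1) = leftHom (driveOp ψ q α) * rightHom (driveOp ψ q α) := by
    rw [← doubled_eq_mul]
    exact (PhaseEq.smul (by simp) _).doubled_eq.symm
  have hc := (commute_leftHom_rightHom (driveOp ψ q α) (driveOp ψ q α)).eq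
  rw [hd, doubledDrive, smul_mul_smul_comm, sub_mul, mul_sub, mul_sub, ← map_mul, ← map_mul, hsq,
    map_one, map_one, ← hc, neg_mul_neg, Complex.I_mul_I]
  module

/-- The generator of the averaged doubled evolution is `-t H_eff`. -/
lemma IsMajorana.generator_eq {ψ : Fin N → Matrix ι ι ℂ} (hψ : IsMajorana ψ) {q : ℕ}
    (hq : Even q) (J t : ℝ) :
    ((J * t / 2 : ℝ) : ℂ) • ∑ α, doubledDrive ψ q α * doubledDrive ψ q α =
      -(t : ℂ) • Heff ψ q J := by
  rw [hψ.Heff_eq hq]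
  simp only [hψ.doubledDrive_mul_self hq, ← Finset.smul_sum, smul_smul]
  congr 1
  push_cast; ring

lemma toOp_doubled_evolution (ψ : Fin N → Matrix ι ι ℂ) (q M : ℕ)
    (x : Fin M → Strings N q → ℝ) :
    toOp (doubled (evolution ψ q M x)) = (List.ofFn fun m : Fin M =>
      NormedSpace.exp (linComb (fun α => toOp (doubledDrive ψ q α)) (x m.rev))).prod := by
  rw [evolution, map_list_prod, map_list_prod, List.map_ofFn, List.map_ofFn]
  simp only [Function.comp_def, toOp_doubled_gate]

/-- The average of `U ⊗ U*` over the circuit with `M` steps. -/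
def avgDoubled (ψ : Fin N → Matrix ι ι ℂ) (q M : ℕ) (J t : ℝ) :
    Matrix (ι × ι) (ι × ι) ℂ :=
  toOp.symm ((∫ x, NormedSpace.exp (linComb (fun α => toOp (doubledDrive ψ q α)) x)
    ∂(Measure.pi fun _ : Strings N q => gaussianReal 0 (Real.toNNReal (J * t / M)))) ^ M)

/-- A matrix entry, as a functional on operators. -/
def entryCLM (p p' : ι) : (EuclideanSpace ℂ ι →L[ℂ] EuclideanSpace ℂ ι) →L[ℂ] ℂ :=
  LinearMap.toContinuousLinearMap
    (Matrix.entryLinearMap ℂ ℂ p p' ∘ₗ (toOp (ι := ι)).symm.toAlgEquiv.toLinearMap)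

lemma entryCLM_apply (p p' : ι) (x : EuclideanSpace ℂ ι →L[ℂ] EuclideanSpace ℂ ι) :
    entryCLM p p' x = toOp.symm x p p' := rfl

lemma entryCLM_toOp (p p' : ι) (X : Matrix ι ι ℂ) : entryCLM p p' (toOp X) = X p p' := by
  rw [entryCLM_apply, StarAlgEquiv.symm_apply_apply]

variable [Nonempty ι]

lemma integral_entry_doubled (ψ : Fin N → Matrix ι ι ℂ) (q M : ℕ) {J t : ℝ} (hJ : 0 ≤ J)
    (ht : 0 ≤ t) (p p' : ι × ι) :
    Integrable (fun x => doubled (evolution ψ q M x) p p') (couplingLaw N q M J t) ∧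
      ∫ x, doubled (evolution ψ q M x) p p' ∂(couplingLaw N q M J t) =
        avgDoubled ψ q M J t p p' := by
  have h := integral_list_prod
    (Measure.pi fun _ : Strings N q => gaussianReal 0 (Real.toNNReal (J * t / M)))
    (integrable_exp_linComb_gaussian (fun α => toOp (doubledDrive ψ q α))
      (by positivity : 0 ≤ J * t / M)) M
  simp only [← toOp_doubled_evolution] at h
  have h1 := (entryCLM p p').integrable_comp h.1
  have h2 := (entryCLM p p').integral_comp_comm h.1
  simp only [entryCLM_toOp] at h1 h2
  refine ⟨h1, h2.trans ?_⟩
  rw [h.2]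
  rfl

lemma IsMajorana.tendsto_avgDoubled {ψ : Fin N → Matrix ι ι ℂ} (hψ : IsMajorana ψ) {q : ℕ}
    (hq : Even q) {J t : ℝ} (hJ : 0 ≤ J) (ht : 0 ≤ t) :
    Tendsto (fun M => avgDoubled ψ q M J t) atTop
      (𝓝 (NormedSpace.exp (-(t : ℂ) • Heff ψ q J))) := by
  have h := (continuous_toOp_symm.tendsto _).comp
    (tendsto_integral_exp_pow (fun α => toOp (doubledDrive ψ q α)) (mul_nonneg hJ ht))
  rw [toOp_symm_exp, map_smul, map_sum] at h
  simp only [map_mul, StarAlgEquiv.symm_apply_apply, hψ.generator_eq hq] at h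
  exact h

omit [Nonempty ι] in
/-- A cyclic product of overlaps as a cyclic contraction, in which each operator occurs once as a
bra and once as a ket. -/
lemma prod_overlap {n : ℕ} (σ : Equiv.Perm (Fin n)) (U : Fin n → Matrix ι ι ℂ) :
    ∏ a, star (choi (U a)) ⬝ᵥ choi (U (σ a)) =
      ∑ p : Fin n → ι × ι, ∏ a, realign (doubled (U (σ a))) (p a) (p (σ a)) := by
  simp only [dotProduct, Finset.prod_univ_sum, Fintype.piFinset_univ]
  refine Finset.sum_congr rfl fun p _ => ?_
  simp only [realign_doubled, vecMulVec_apply, Finset.prod_mul_distrib]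
  rw [mul_comm]
  congr 1
  exact (Equiv.prod_comp σ fun a => star (choi (U a)) (p a)).symm

lemma integral_realign_doubled (ψ : Fin N → Matrix ι ι ℂ) (q M : ℕ) {J t : ℝ} (hJ : 0 ≤ J)
    (ht : 0 ≤ t) (p p' : ι × ι) :
    Integrable (fun x => realign (doubled (evolution ψ q M x)) p p') (couplingLaw N q M J t) ∧
      ∫ x, realign (doubled (evolution ψ q M x)) p p' ∂(couplingLaw N q M J t) =
        realign (avgDoubled ψ q M J t) p p' := by
  have h := integral_entry_doubled ψ q M hJ ht (p.1, p'.1) (p.2, p'.2)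
  refine ⟨h.1.const_mul _, ?_⟩
  simp only [realign]
  rw [integral_const_mul, h.2]

instance (N q M : ℕ) (J t : ℝ) : IsProbabilityMeasure (couplingLaw N q M J t) := by
  unfold couplingLaw; infer_instance

omit [Nonempty ι] [DecidableEq ι] [Fintype ι] in
/-- The average over independent draws of a cyclic contraction is the contraction of the
averages. -/
lemma integral_cycle {n : ℕ} {X κ : Type*} [MeasurableSpace X] [Fintype κ] (ν : Measure X)
    [IsProbabilityMeasure ν] (σ : Equiv.Perm (Fin n)) (F : X → Matrix κ κ ℂ) {R : Matrix κ κ ℂ}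
    (hF : ∀ p p', Integrable (fun x => F x p p') ν ∧ ∫ x, F x p p' ∂ν = R p p') :
    ∫ x : Fin n → X, ∑ p : Fin n → κ, ∏ a, F (x (σ a)) (p a) (p (σ a))
      ∂(Measure.pi fun _ => ν) = ∑ p : Fin n → κ, ∏ a, R (p a) (p (σ a)) := by
  have h : ∀ (p : Fin n → κ) (x : Fin n → X), ∏ a, F (x (σ a)) (p a) (p (σ a)) =
      ∏ a, F (x a) (p (σ.symm a)) (p a) := by
    intro p x
    rw [← Equiv.prod_comp σ fun a => F (x a) (p (σ.symm a)) (p a)]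
    simp only [Equiv.symm_apply_apply]
  simp only [h]
  rw [integral_finsetSum _ fun p _ => Integrable.fintype_prod_dep
    (f := fun a x => F x (p (σ.symm a)) (p a)) fun a => (hF _ _).1]
  refine Finset.sum_congr rfl fun p _ => ?_
  rw [integral_fintype_prod_eq_prod fun a x => F x (p (σ.symm a)) (p a)]
  simp only [(hF _ _).2]
  rw [← Equiv.prod_comp σ]
  simp only [Equiv.symm_apply_apply]

lemma discreteMoment_eq (ψ : Fin N → Matrix ι ι ℂ) (q : ℕ) {n : ℕ} (hn : 1 ≤ n) (M : ℕ) {J t : ℝ}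
    (hJ : 0 ≤ J) (ht : 0 ≤ t) :
    discreteMoment ψ q n M J t = (realign (avgDoubled ψ q M J t) ^ n).trace := by
  rw [← sum_cycle_prod hn, ← integral_cycle (couplingLaw N q M J t) (finRotate n)
    (fun x => realign (doubled (evolution ψ q M x))) (integral_realign_doubled ψ q M hJ ht)]
  unfold discreteMoment
  refine integral_congr_ae (Eventually.of_forall fun x => ?_)
  exact prod_overlap (finRotate n) fun a => evolution ψ q M (x a)

omit [DecidableEq ι] [Nonempty ι] in
lemma continuous_realign : Continuous (realign (ι := ι)) := by
  refine continuous_matrix fun p p' => ?_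
  change Continuous fun P : Matrix (ι × ι) (ι × ι) ℂ =>
    (Fintype.card ι : ℂ)⁻¹ * P (p.1, p'.1) (p.2, p'.2)
  fun_prop

lemma IsMajorana.tendsto_discreteMoment {ψ : Fin N → Matrix ι ι ℂ} (hψ : IsMajorana ψ) {q : ℕ}
    (hq : Even q) {J t : ℝ} (hJ : 0 ≤ J) (ht : 0 ≤ t) {n : ℕ} (hn : 1 ≤ n) :
    Tendsto (fun M => discreteMoment ψ q n M J t) atTop (𝓝 (rho ψ q J t ^ n).trace) := by
  simp only [discreteMoment_eq ψ q hn _ hJ ht]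
  rw [← hψ.realign_exp_Heff hq]
  have hcont : Continuous fun P : Matrix (ι × ι) (ι × ι) ℂ => (realign P ^ n).trace :=
    (continuous_realign.pow n).matrix_trace
  exact (hcont.tendsto _).comp (hψ.tendsto_avgDoubled hq hJ ht)

end Circuit

end BrownianSYK

end

theorem mainTheorem5 {ι : Type*} [Fintype ι] [DecidableEq ι] {N : ℕ}
    (ψ : Fin N → Matrix ι ι ℂ) (hψ : BrownianSYK.IsMajorana ψ)
    (q : ℕ) (hq : Even q) (J t : ℝ) (hJ : 0 ≤ J) (ht : 0 ≤ t) :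
    -- the states of the even strings are orthonormal eigenvectors of `ρ_t`
    (∀ α β : Finset (Fin N), Even α.card → Even β.card →
      star (BrownianSYK.choi (BrownianSYK.majString ψ α)) ⬝ᵥ
        BrownianSYK.choi (BrownianSYK.majString ψ β) = if α = β then 1 else 0) ∧
    (∀ α : Finset (Fin N), Even α.card →
      (BrownianSYK.rho ψ q J t).mulVec (BrownianSYK.choi (BrownianSYK.majString ψ α)) =
        (BrownianSYK.eigval N q J t α.card : ℂ) •
          BrownianSYK.choi (BrownianSYK.majString ψ α)) ∧
    ∀ n : ℕ, 1 ≤ n →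
      -- the overlap moment of the Brownian ensemble, in the continuum limit
      Filter.Tendsto (fun M : ℕ => BrownianSYK.discreteMoment ψ q n M J t) Filter.atTop
        (nhds ((BrownianSYK.rho ψ q J t) ^ n).trace) ∧
      -- its expression through the effective Hamiltonian
      BrownianSYK.replicaMoment ψ q n J t = ((BrownianSYK.rho ψ q J t) ^ n).trace ∧
      -- its expressions through Majorana strings
      (Even N → ∀ A : Finset (Finset (Fin N)), BrownianSYK.IsHalf A →
        (BrownianSYK.stringMomentEven ψ A q n J t : ℂ) =
          ((BrownianSYK.rho ψ q J t) ^ n).trace) ∧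
      (Odd N → ∀ A : Finset (Finset (Fin N)), BrownianSYK.IsHalf A →
        (BrownianSYK.stringMomentOdd ψ A q n J t : ℂ) =
          ((BrownianSYK.rho ψ q J t) ^ n).trace) ∧
      -- the spectral moment written out
      ((BrownianSYK.rho ψ q J t) ^ n).trace =
        ((∑ s ∈ Finset.range (N + 1) with Even s,
          (N.choose s : ℝ) * BrownianSYK.eigval N q J t s ^ n : ℝ) : ℂ) := by
  have : Nonempty ι := hψ.nonempty
  refine ⟨fun α β hα hβ => hψ.choi_orthonormal hα hβ, fun α hα => hψ.rho_mulVec q J t hα,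
    fun n hn => ⟨hψ.tendsto_discreteMoment hq hJ ht hn, ?_,
      fun hN A hA => hψ.stringMomentEven_eq hN hA hq hn J t,
      fun hN A hA => hψ.stringMomentOdd_eq hN hA hq hn J t, ?_⟩⟩
  · rw [BrownianSYK.replicaMoment_eq ψ q hn, hψ.realign_exp_Heff hq]
  · rw [hψ.trace_rho_pow q J t hn,
      BrownianSYK.sum_even_card fun s => BrownianSYK.eigval N q J t s ^ n]
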